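/- Let $\zeta\in\mathbb T$, $n\ge 0$, $d_1,\dots,d_n\in\mathbb Z$, and let the circle act on $V=\mathbb C^n$ by $\pi_z(e_i)=z^{d_i}e_i$. Let $\omega=\sum_{i,j}\omega_{ij}\,e_i\otimes e_j\in V\otimes V$ be homogeneous of degree $d$ (that is, $\omega_{ij}=0$ unless $d_i+d_j=d$), and assume that its matrix $\Omega=(\omega_{ij})$ satisfies $\overline\Omega\,\Omega=c\cdot\pi_{\zeta^d}$ for some $c\in\mathbb C^\times$. The C$^*$-algebra $A_o(V,\pi,\omega)$ is the universal unital C$^*$-algebra with generators $u_{ij}$, $1\le i,j\le n$, subject to the relations that $u=(u_{ij})$ is unitary and $$\zeta^{d_jd_i}\sum_k\omega_{ik}u_{jk}=\zeta^{d_j(d-d_j)}\sum_k\omega_{kj}u_{ki}^*\qquad(1\le i,j\le n).$$ It carries the circle action $\beta_z(u_{ik})=z^{d_k-d_i}u_{ik}$. Choose a faithful representation of $A_o(V,\pi,\omega)$ on a Hilbert space $L$ that is equivariant for a continuous unitary representation $U$ of $\mathbb T$ on $L$. Let $C$ be the C$^*$-algebra of the bosonisation, that is, the braided tensor product $\mathrm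 C(\mathbb T)\boxtimes_\zeta A_o(V,\pi,\omega)$: the C$^*$-algebra of operators on $L^2(\mathbb T)\otimes L$ generated by the unitary $z$ of multiplication by the coordinate function (tensored with $1_L$) and by the operators $j_2(b)$ for $b\in A_o(V,\pi,\omega)$, where $j_2(b)(z^k\otimes\lambda)=z^k\otimes U_{\zeta^k}\,b\,U_{\zeta^{-k}}\lambda$. Write $u_{ij}$ for $j_2(u_{ij})$ and put $t_{ij}=z^{d_i}u_{ij}\in C$. For $F\in M_n(\mathbb C)$ let $A_o(F)$ be the universal unital C$^*$-algebra with generators $x_{ij}$ such that $x=(x_{ij})$ is unitary and $xF=F\overline x$, where $\overline x=(x_{ij}^*)$; its comultiplication is $\Delta_{A_o(F)}(x_{ij})=\sum_k x_{ik}\otimes x_{kj}$. Tensor products of C$^*$-algebras are spatial. Assume $d=0$ and let $F=\Omega^{\top}$. Then $\alpha(x_{ij})=\zeta^{d_i-d_j}x_{ij}$ defines an automorphism $\alpha$ of $A_o(F)$, and the following hold. 1. There is a unique unital $*$-homomorphism $\Delta_C\colon C\to C\otimes C$ with $\Delta_C(z)=z\otimes z$ and $\Delta_C(u_{ik})=\sum_l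 u_{il}\otimes z^{d_l-d_i}u_{lk}$. 2. There is a unique unital $*$-homomorphism $\varphi\colon A_o(F)\to C$ with $\varphi(x_{ij})=t_{ij}$ for all $i,j$, and it is a Hopf $*$-homomorphism: $(\varphi\otimes\varphi)\circ\Delta_{A_o(F)}=\Delta_C\circ\varphi$. 3. $\varphi$ extends to a $*$-isomorphism $\Phi\colon A_o(F)\rtimes_\alpha\mathbb Z\to C$: if $\iota\colon A_o(F)\to A_o(F)\rtimes_\alpha\mathbb Z$ is the canonical map, then $\Phi\circ\iota=\varphi$; and $\Phi$ maps the canonical unitary that implements $\alpha$ to $z$. 4. In particular, $\varphi$ is injective. -/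

import Mathlib

open scoped TensorProduct InnerProductSpace

noncomputable section

namespace BraidedOrth

/-! ### C*-seminorms and completions -/

/-- A C*-seminorm on a unital complex `*`-algebra. The inequality `p a ^ 2 ≤ p (a* a)` together
with submultiplicativity gives the usual identity `p (a* a) = p a ^ 2`. -/
structure CStarSeminorm (E : Type*) [Ring E] [StarRing E] [Algebra ℂ E] extends Seminorm ℂ E where
  mul_le' : ∀ a b : E, toFun (a * b) ≤ toFun a * toFun b
  cstar' : ∀ a : E, toFun a * toFun a ≤ toFun (star a * a)

namespace CStarSeminorm

variable {E : Type*} [Ring E] [StarRing E] [Algebra ℂ E]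

instance : CoeFun (CStarSeminorm E) fun _ => E → ℝ := ⟨fun p => p.toSeminorm⟩

theorem mul_le (p : CStarSeminorm E) (a b : E) : p (a * b) ≤ p a * p b := p.mul_le' a b

theorem cstar (p : CStarSeminorm E) (a : E) : p a * p a ≤ p (star a * a) := p.cstar' a

theorem star_eq (p : CStarSeminorm E) (a : E) : p (star a) = p a := by
  have key : ∀ b : E, p b ≤ p (star b) := by
    intro b
    have h := (p.cstar b).trans (p.mul_le _ _)
    rcases (apply_nonneg p.toSeminorm b).eq_or_lt with h0 | h0
    · rw [← h0]; exact apply_nonneg p.toSeminorm _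
    · exact le_of_mul_le_mul_right h h0
  exact le_antisymm (by simpa using key (star a)) (key a)

/-- The supremum of a pointwise bounded family of C*-seminorms. -/
def sup {ι : Type*} (q : ι → CStarSeminorm E)
    (hq : ∀ a, BddAbove (Set.range fun i => q i a)) : CStarSeminorm E where
  toFun a := ⨆ i, q i a
  map_zero' := by simp
  add_le' a b := by
    refine Real.iSup_le (fun i => ?_)
      (add_nonneg (Real.iSup_nonneg fun i => apply_nonneg _ _)
        (Real.iSup_nonneg fun i => apply_nonneg _ _))
    exact (map_add_le_add _ _ _).trans (add_le_add (le_ciSup (hq a) i) (le_ciSup (hq b) i))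
  neg' a := by simp
  smul' c a := by simp [map_smul_eq_mul, Real.mul_iSup_of_nonneg]
  mul_le' a b := by
    refine Real.iSup_le (fun i => ?_)
      (mul_nonneg (Real.iSup_nonneg fun i => apply_nonneg _ _)
        (Real.iSup_nonneg fun i => apply_nonneg _ _))
    exact ((q i).mul_le _ _).trans (mul_le_mul (le_ciSup (hq a) i) (le_ciSup (hq b) i)
      (apply_nonneg _ _) (Real.iSup_nonneg fun i => apply_nonneg _ _))
  cstar' a := by
    have h0 : 0 ≤ ⨆ i, q i (star a * a) := Real.iSup_nonneg fun i => apply_nonneg _ _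
    have h : (⨆ i, q i a) ≤ √(⨆ i, q i (star a * a)) := by
      refine Real.iSup_le (fun i => Real.le_sqrt_of_sq_le ?_) (Real.sqrt_nonneg _)
      rw [sq]
      exact ((q i).cstar a).trans (le_ciSup (hq (star a * a)) i)
    calc _ ≤ √(⨆ i, q i (star a * a)) * √(⨆ i, q i (star a * a)) :=
          mul_le_mul h h (Real.iSup_nonneg fun i => apply_nonneg _ _) (Real.sqrt_nonneg _)
      _ = _ := Real.mul_self_sqrt h0

theorem le_sup {ι : Type*} (q : ι → CStarSeminorm E)
    (hq : ∀ a, BddAbove (Set.range fun i => q i a)) (i : ι) (a : E) : q i a ≤ sup q hq a :=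
  le_ciSup (hq a) i

/-- The C*-seminorm `a ↦ ‖f a‖` of a `*`-homomorphism to a C*-algebra. -/
def ofHom {B : Type*} [CStarAlgebra B] (f : E →⋆ₐ[ℂ] B) : CStarSeminorm E where
  toFun a := ‖f a‖
  map_zero' := by simp
  add_le' a b := by simpa using norm_add_le _ _
  neg' a := by simp
  smul' c a := by simp [norm_smul]
  mul_le' a b := by simpa using norm_mul_le _ _
  cstar' a := by simp [map_mul, map_star, CStarRing.norm_star_mul_self]

@[simp] theorem ofHom_apply {B : Type*} [CStarAlgebra B] (f : E →⋆ₐ[ℂ] B) (a : E) :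
    ofHom f a = ‖f a‖ := rfl

end CStarSeminorm

section Completion

universe u

variable {E : Type u} [Ring E] [StarRing E] [Algebra ℂ E]

/-- The `*`-algebra `E`, equipped with the topology of a C*-seminorm. -/
def PreCStar (_p : CStarSeminorm E) : Type u := E

variable (p : CStarSeminorm E)

instance : Ring (PreCStar p) := inferInstanceAs (Ring E)
instance : StarRing (PreCStar p) := inferInstanceAs (StarRing E)
instance : Algebra ℂ (PreCStar p) := inferInstanceAs (Algebra ℂ E)

instance : SeminormedRing (PreCStar p) where
  __ := (inferInstance : Ring (PreCStar p))
  __ := p.toSeminorm.toAddGroupSeminorm.toSeminormedAddCommGroup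
  norm_mul_le a b := p.mul_le a b

theorem PreCStar.norm_def (a : PreCStar p) : ‖a‖ = p a := rfl

instance : NormedAlgebra ℂ (PreCStar p) where
  __ := (inferInstance : Algebra ℂ (PreCStar p))
  norm_smul_le c a := (map_smul_eq_mul p.toSeminorm c a).le

instance : NormedStarGroup (PreCStar p) where
  norm_star_le a := (p.star_eq a).le

/-- The C*-algebra obtained from a `*`-algebra with a C*-seminorm by dividing out the null space
and completing. -/
def CStarCompletion : Type u := UniformSpace.Completion (PreCStar p)

namespace CStarCompletion

open UniformSpace

instance : NormedRing (CStarCompletion p) :=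
  inferInstanceAs (NormedRing (Completion (PreCStar p)))
instance : CompleteSpace (CStarCompletion p) :=
  inferInstanceAs (CompleteSpace (Completion (PreCStar p)))
instance : Algebra ℂ (CStarCompletion p) :=
  inferInstanceAs (Algebra ℂ (Completion (PreCStar p)))

instance : NormedAlgebra ℂ (CStarCompletion p) where
  norm_smul_le c a := by
    exact NormedSpace.norm_smul_le (E := Completion (PreCStar p)) c a

/-- The image of an element of the `*`-algebra in the completion. -/
def coe (a : E) : CStarCompletion p := ((show PreCStar p from a : PreCStar p) :
  Completion (PreCStar p))

@[simp] theorem norm_coe (a : E) : ‖coe p a‖ = p a :=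
  Completion.norm_coe (E := PreCStar p) a

theorem denseRange_coe : DenseRange (coe p) := Completion.denseRange_coe (α := PreCStar p)

theorem induction {P : CStarCompletion p → Prop} (x : CStarCompletion p)
    (hc : IsClosed {x | P x}) (h : ∀ a, P (coe p a)) : P x :=
  Completion.induction_on x hc h

theorem coe_add (a b : E) : coe p (a + b) = coe p a + coe p b :=
  Completion.coe_add (α := PreCStar p) a b
theorem coe_mul (a b : E) : coe p (a * b) = coe p a * coe p b :=
  Completion.coe_mul (α := PreCStar p) a b
theorem coe_one : coe p (1 : E) = 1 := rfl
theorem coe_smul (c : ℂ) (a : E) : coe p (c • a) = c • coe p a :=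
  Completion.coe_smul (X := PreCStar p) c a

theorem uniformContinuous_star : UniformContinuous (star : PreCStar p → PreCStar p) :=
  (starNormedAddGroupHom (E := PreCStar p)).uniformContinuous

instance : Star (CStarCompletion p) := ⟨Completion.map (star : PreCStar p → PreCStar p)⟩

theorem continuous_star : Continuous (star : CStarCompletion p → CStarCompletion p) :=
  Completion.continuous_map (f := (star : PreCStar p → PreCStar p))

theorem coe_star (a : E) : coe p (star a) = star (coe p a) :=
  (Completion.map_coe (uniformContinuous_star p) a).symm

instance : StarRing (CStarCompletion p) where
  star_involutive x := by
    induction x using induction with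
    | hc => exact isClosed_eq ((continuous_star p).comp (continuous_star p)) continuous_id
    | h a => rw [← coe_star, ← coe_star, star_star]
  star_mul x y := by
    induction x using induction with
    | hc => exact isClosed_eq ((continuous_star p).comp (continuous_id.mul continuous_const))
              (continuous_const.mul (continuous_star p))
    | h a =>
      induction y using induction with
      | hc => exact isClosed_eq ((continuous_star p).comp (continuous_const.mul continuous_id))
                ((continuous_star p).mul continuous_const)
      | h b => rw [← coe_mul, ← coe_star, ← coe_star, ← coe_star, star_mul, coe_mul]
  star_add x y := by
    induction x using induction with
    | hc => exact isClosed_eq ((continuous_star p).comp (continuous_id.add continuous_const))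
              ((continuous_star p).add continuous_const)
    | h a =>
      induction y using induction with
      | hc => exact isClosed_eq ((continuous_star p).comp (continuous_const.add continuous_id))
                (continuous_const.add (continuous_star p))
      | h b => rw [← coe_add, ← coe_star, ← coe_star, ← coe_star, star_add, coe_add]

instance [StarModule ℂ E] : CStarAlgebra (CStarCompletion p) where
  norm_mul_self_le x := by
    induction x using induction with
    | hc => exact isClosed_le (continuous_norm.mul continuous_norm)
              (continuous_norm.comp ((continuous_star p).mul continuous_id))
    | h a => rw [← coe_star, ← coe_mul, norm_coe, norm_coe]; exact p.cstar a
  star_smul c x := by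
    induction x using induction with
    | hc => exact isClosed_eq ((continuous_star p).comp (continuous_const_smul c))
              ((continuous_const_smul (star c)).comp (continuous_star p))
    | h a => rw [← coe_smul, ← coe_star, ← coe_star, star_smul, coe_smul]

/-- The canonical `*`-homomorphism to the completion. -/
def of : E →⋆ₐ[ℂ] CStarCompletion p where
  toFun := coe p
  map_one' := coe_one p
  map_mul' := coe_mul p
  map_zero' := rfl
  map_add' := coe_add p
  commutes' c := by rw [Algebra.algebraMap_eq_smul_one, Algebra.algebraMap_eq_smul_one, coe_smul,
    coe_one]
  map_star' := coe_star p

theorem of_apply (a : E) : of p a = coe p a := rfl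

@[simp] theorem norm_of (a : E) : ‖of p a‖ = p a := norm_coe p a

theorem denseRange_of : DenseRange (of p) := denseRange_coe p

variable {B : Type*} [CStarAlgebra B]

/-- A `*`-homomorphism that is bounded by the seminorm extends to the completion. -/
def lift (f : E →⋆ₐ[ℂ] B) (hf : ∀ a, ‖f a‖ ≤ p a) : CStarCompletion p →⋆ₐ[ℂ] B :=
  have hu : UniformContinuous (fun a : PreCStar p => f a) :=
    (AddMonoidHomClass.lipschitz_of_bound (show PreCStar p →+ B from (f : E →+ B)) 1
      (by intro a; rw [one_mul]; exact hf a)).uniformContinuous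
  have hc : Continuous (Completion.extension (fun a : PreCStar p => f a) :
      CStarCompletion p → B) := Completion.continuous_extension
  have he : ∀ a : E, (Completion.extension (fun a : PreCStar p => f a) :
      CStarCompletion p → B) (coe p a) = f a := fun a => Completion.extension_coe hu a
  { toFun := (Completion.extension (fun a : PreCStar p => f a) : CStarCompletion p → B)
    map_one' := by rw [← coe_one, he, map_one]
    map_zero' := by
      have : (0 : CStarCompletion p) = coe p 0 := rfl
      rw [this, he, map_zero]
    map_mul' := fun x y => by
      induction x using induction with
      | hc => exact isClosed_eq (hc.comp (continuous_id.mul continuous_const))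
                (hc.mul continuous_const)
      | h a =>
        induction y using induction with
        | hc => exact isClosed_eq (hc.comp (continuous_const.mul continuous_id))
                  (continuous_const.mul hc)
        | h b => rw [← coe_mul, he, he, he, map_mul]
    map_add' := fun x y => by
      induction x using induction with
      | hc => exact isClosed_eq (hc.comp (continuous_id.add continuous_const))
                (hc.add continuous_const)
      | h a =>
        induction y using induction with
        | hc => exact isClosed_eq (hc.comp (continuous_const.add continuous_id))
                  (continuous_const.add hc)
        | h b => rw [← coe_add, he, he, he, map_add]
    commutes' := fun c => by
      rw [Algebra.algebraMap_eq_smul_one, ← coe_one, ← coe_smul, he, map_smul, map_one,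
        Algebra.algebraMap_eq_smul_one]
    map_star' := fun x => by
      induction x using induction with
      | hc => exact isClosed_eq (hc.comp (continuous_star p)) hc.star
      | h a => rw [← coe_star, he, he, map_star] }

@[simp] theorem lift_of (f : E →⋆ₐ[ℂ] B) (hf : ∀ a, ‖f a‖ ≤ p a) (a : E) :
    lift p f hf (of p a) = f a :=
  Completion.extension_coe (α := PreCStar p)
    (AddMonoidHomClass.lipschitz_of_bound (show PreCStar p →+ B from (f : E →+ B)) 1
      (by intro a; rw [one_mul]; exact hf a)).uniformContinuous a

theorem hom_ext [StarModule ℂ E] {f g : CStarCompletion p →⋆ₐ[ℂ] B} (h : ∀ a, f (of p a) = g (of p a)) :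
    f = g := by
  have hc : ∀ k : CStarCompletion p →⋆ₐ[ℂ] B, Continuous k := fun k =>
    (AddMonoidHomClass.continuous_of_bound k 1
      (by intro a; rw [one_mul]; exact NonUnitalStarAlgHom.norm_apply_le k a))
  exact DFunLike.coe_injective ((denseRange_of p).equalizer (hc f) (hc g) (funext h))

end CStarCompletion

end Completion

/-! ### Universal C*-algebras given by generators and relations -/

/-- The free unital complex `*`-algebra on a set `X`: noncommutative polynomials in the
variables `x` (`Sum.inl x`) and `x*` (`Sum.inr x`). -/
def FreeStar (X : Type*) : Type _ := FreeAlgebra ℂ (X ⊕ X)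

namespace FreeStar

variable {X : Type*}

instance : Ring (FreeStar X) := inferInstanceAs (Ring (FreeAlgebra ℂ (X ⊕ X)))
instance : Algebra ℂ (FreeStar X) := inferInstanceAs (Algebra ℂ (FreeAlgebra ℂ (X ⊕ X)))

/-- The generator `x`. -/
def gen (x : X) : FreeStar X := FreeAlgebra.ι ℂ (Sum.inl x)

/-- The generator `x` or its formal adjoint. -/
def letter (y : X ⊕ X) : FreeStar X := FreeAlgebra.ι ℂ y

theorem induction {P : FreeStar X → Prop} (h₁ : ∀ c : ℂ, P (algebraMap ℂ (FreeStar X) c))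
    (h₂ : ∀ y, P (letter y)) (h₃ : ∀ a b, P a → P b → P (a * b))
    (h₄ : ∀ a b, P a → P b → P (a + b)) (a : FreeStar X) : P a :=
  FreeAlgebra.induction ℂ (X ⊕ X) h₁ h₂ h₃ h₄ a

/-- The conjugate-linear anti-homomorphism that exchanges `x` and `x*`. -/
def conj : FreeStar X →+* (FreeStar X)ᵐᵒᵖ :=
  letI : Algebra ℂ (FreeStar X)ᵐᵒᵖ :=
    RingHom.toAlgebra' ((algebraMap ℂ (FreeStar X)ᵐᵒᵖ).comp (starRingEnd ℂ))
      fun c x => Algebra.commutes (starRingEnd ℂ c) x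
  (FreeAlgebra.lift ℂ (fun y : X ⊕ X => MulOpposite.op (letter y.swap)) :
    FreeAlgebra ℂ (X ⊕ X) →ₐ[ℂ] (FreeStar X)ᵐᵒᵖ).toRingHom

theorem conj_letter (y : X ⊕ X) : conj (letter y) = MulOpposite.op (letter y.swap) := by
  let _ : Algebra ℂ (FreeStar X)ᵐᵒᵖ :=
    RingHom.toAlgebra' ((algebraMap ℂ (FreeStar X)ᵐᵒᵖ).comp (starRingEnd ℂ))
      fun c x => Algebra.commutes (starRingEnd ℂ c) x
  exact FreeAlgebra.lift_ι_apply (R := ℂ) (A := (FreeStar X)ᵐᵒᵖ)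
    (fun y : X ⊕ X => MulOpposite.op (letter y.swap)) y

theorem conj_algebraMap (c : ℂ) : conj (algebraMap ℂ (FreeStar X) c) =
    MulOpposite.op (algebraMap ℂ (FreeStar X) (starRingEnd ℂ c)) := by
  let _ : Algebra ℂ (FreeStar X)ᵐᵒᵖ :=
    RingHom.toAlgebra' ((algebraMap ℂ (FreeStar X)ᵐᵒᵖ).comp (starRingEnd ℂ))
      fun c x => Algebra.commutes (starRingEnd ℂ c) x
  exact AlgHom.commutes (FreeAlgebra.lift ℂ (A := (FreeStar X)ᵐᵒᵖ)
    (fun y : X ⊕ X => MulOpposite.op (letter y.swap))) c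

instance : StarRing (FreeStar X) where
  star a := (conj a).unop
  star_involutive a := by
    induction a using induction with
    | h₁ c => simp [conj_algebraMap]
    | h₂ y => simp [conj_letter]
    | h₃ a b ha hb => simp_all
    | h₄ a b ha hb => simp_all
  star_mul a b := by simp
  star_add a b := by simp

theorem star_def (a : FreeStar X) : star a = (conj a).unop := rfl

instance : StarModule ℂ (FreeStar X) where
  star_smul c a := by
    simp only [star_def, Algebra.smul_def, map_mul, conj_algebraMap, MulOpposite.unop_mul,
      MulOpposite.unop_op]
    exact (Algebra.commutes _ _).symm

theorem letter_inl (x : X) : letter (Sum.inl x) = gen x := rfl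

theorem letter_inr (x : X) : letter (Sum.inr x) = star (gen x) := by
  rw [star_def, ← letter_inl, conj_letter]; rfl

variable {B : Type*} [Ring B] [StarRing B] [Algebra ℂ B]

/-- Evaluation of noncommutative `*`-polynomials. -/
def lift [StarModule ℂ B] (f : X → B) : FreeStar X →⋆ₐ[ℂ] B where
  __ := (FreeAlgebra.lift ℂ (Sum.elim f fun x => star (f x)) : FreeAlgebra ℂ (X ⊕ X) →ₐ[ℂ] B)
  map_star' a := by
    let F : FreeStar X →ₐ[ℂ] B := FreeAlgebra.lift ℂ (Sum.elim f fun x => star (f x))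
    have hF : ∀ y, F (letter y) = Sum.elim f (fun x => star (f x)) y := fun y =>
      FreeAlgebra.lift_ι_apply _ y
    change F (star a) = star (F a)
    induction a using induction with
    | h₁ c =>
      rw [Algebra.algebraMap_eq_smul_one, star_smul, star_one, map_smul, map_smul, map_one,
        star_smul, star_one]
    | h₂ y =>
      rw [star_def, conj_letter, MulOpposite.unop_op, hF, hF]
      rcases y with x | x <;> simp
    | h₃ a b ha hb => rw [star_mul, map_mul, map_mul, star_mul, ha, hb]
    | h₄ a b ha hb => rw [star_add, map_add, map_add, star_add, ha, hb]

@[simp] theorem lift_gen [StarModule ℂ B] (f : X → B) (x : X) : lift f (gen x) = f x :=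
  FreeAlgebra.lift_ι_apply (R := ℂ) (A := B) _ _

theorem hom_ext {f g : FreeStar X →⋆ₐ[ℂ] B} (h : ∀ x, f (gen x) = g (gen x)) (a : FreeStar X) :
    f a = g a := by
  induction a using induction with
  | h₁ c => simp only [Algebra.algebraMap_eq_smul_one, map_smul, map_one]
  | h₂ y =>
    rcases y with x | x
    · rw [letter_inl, h]
    · rw [letter_inr, map_star, map_star, h]
  | h₃ a b ha hb => rw [map_mul, map_mul, ha, hb]
  | h₄ a b ha hb => rw [map_add, map_add, ha, hb]

end FreeStar

universe v

section Universal

variable {X : Type v} (R : Set (FreeStar X))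

/-- The C*-seminorms on the free `*`-algebra that vanish on the relations. -/
def RelSeminorm : Type v := {q : CStarSeminorm (FreeStar X) // ∀ r ∈ R, q r = 0}

/-- The relations `R` bound the generators, so that a universal C*-algebra exists. -/
def BoundedRel : Prop := ∀ x : X, ∃ M : ℝ, ∀ q : RelSeminorm R, q.1 (FreeStar.gen x) ≤ M

variable {R}

theorem BoundedRel.bddAbove (h : BoundedRel R) (a : FreeStar X) :
    BddAbove (Set.range fun q : RelSeminorm R => q.1 a) := by
  induction a using FreeStar.induction with
  | h₁ c =>
    refine ⟨‖c‖, ?_⟩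
    rintro _ ⟨q, rfl⟩
    have h1 : q.1 (1 : FreeStar X) ≤ 1 := by
      have := q.1.cstar (1 : FreeStar X)
      rw [star_one, one_mul] at this
      by_contra hlt
      push Not at hlt
      nlinarith
    change q.1.toSeminorm _ ≤ _
    rw [Algebra.algebraMap_eq_smul_one, map_smul_eq_mul]
    exact mul_le_of_le_one_right (norm_nonneg c) h1
  | h₂ y =>
    obtain ⟨M, hM⟩ := h (y.elim id id)
    refine ⟨M, ?_⟩
    rintro _ ⟨q, rfl⟩
    rcases y with x | x
    · exact hM q
    · change q.1 (FreeStar.letter (Sum.inr x)) ≤ _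
      rw [FreeStar.letter_inr, q.1.star_eq]; exact hM q
  | h₃ a b ha hb =>
    obtain ⟨M, hM⟩ := ha
    obtain ⟨N, hN⟩ := hb
    refine ⟨M * N, ?_⟩
    rintro _ ⟨q, rfl⟩
    have h1 : q.1 a ≤ M := hM ⟨q, rfl⟩
    have h2 : q.1 b ≤ N := hN ⟨q, rfl⟩
    exact (q.1.mul_le a b).trans (mul_le_mul h1 h2 (apply_nonneg q.1.toSeminorm b)
      ((apply_nonneg q.1.toSeminorm a).trans h1))
  | h₄ a b ha hb =>
    obtain ⟨M, hM⟩ := ha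
    obtain ⟨N, hN⟩ := hb
    refine ⟨M + N, ?_⟩
    rintro _ ⟨q, rfl⟩
    exact (map_add_le_add q.1.toSeminorm a b).trans (add_le_add (hM ⟨q, rfl⟩) (hN ⟨q, rfl⟩))

/-- It suffices to bound the generators in all C*-algebras that satisfy the relations. -/
theorem BoundedRel.of_rep
    (h : ∀ x : X, ∃ M : ℝ, ∀ (B : Type v) [CStarAlgebra B] (f : FreeStar X →⋆ₐ[ℂ] B),
      (∀ r ∈ R, f r = 0) → ‖f (FreeStar.gen x)‖ ≤ M) : BoundedRel R := by
  intro x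
  obtain ⟨M, hM⟩ := h x
  refine ⟨M, fun q => ?_⟩
  have := hM (CStarCompletion q.1) (CStarCompletion.of q.1) fun r hr => by
    rw [← norm_eq_zero, CStarCompletion.norm_of]; exact q.2 r hr
  rwa [CStarCompletion.norm_of] at this

/-- The largest C*-seminorm that vanishes on the relations. -/
def univSeminorm (h : BoundedRel R) : CStarSeminorm (FreeStar X) :=
  CStarSeminorm.sup (fun q : RelSeminorm R => q.1) h.bddAbove

/-- The universal unital C*-algebra with generators `X` and relations `r = 0` for `r ∈ R`: the
Hausdorff completion of the free `*`-algebra on `X` in the largest C*-seminorm that vanishes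
on `R`. -/
abbrev UnivCStar (h : BoundedRel R) : Type v := CStarCompletion (univSeminorm h)

namespace UnivCStar

variable (h : BoundedRel R)

/-- The generators of the universal C*-algebra. -/
def gen (x : X) : UnivCStar h := CStarCompletion.of (univSeminorm h) (FreeStar.gen x)

theorem of_rel {r : FreeStar X} (hr : r ∈ R) : CStarCompletion.of (univSeminorm h) r = 0 := by
  rw [← norm_eq_zero, CStarCompletion.norm_of]
  refine le_antisymm (Real.iSup_le (fun q => (q.2 r hr).le) le_rfl)
    (apply_nonneg (univSeminorm h).toSeminorm r)

theorem of_eq_lift : CStarCompletion.of (univSeminorm h) = FreeStar.lift (gen h) := by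
  ext a
  exact FreeStar.hom_ext (fun x => by rw [FreeStar.lift_gen]; rfl) a

/-- The generators satisfy the relations. -/
theorem lift_gen_rel {r : FreeStar X} (hr : r ∈ R) : FreeStar.lift (gen h) r = 0 := by
  rw [← of_eq_lift]; exact of_rel h hr

variable {B : Type*} [CStarAlgebra B]

theorem norm_lift_le (f : X → B) (hf : ∀ r ∈ R, FreeStar.lift f r = 0) (a : FreeStar X) :
    ‖FreeStar.lift f a‖ ≤ univSeminorm h a :=
  CStarSeminorm.le_sup (fun q : RelSeminorm R => q.1) h.bddAbove
    ⟨CStarSeminorm.ofHom (FreeStar.lift f), fun r hr => by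
      rw [CStarSeminorm.ofHom_apply, hf r hr, norm_zero]⟩ a

/-- The universal property. -/
def lift (f : X → B) (hf : ∀ r ∈ R, FreeStar.lift f r = 0) : UnivCStar h →⋆ₐ[ℂ] B :=
  CStarCompletion.lift (univSeminorm h) (FreeStar.lift f) (norm_lift_le h f hf)

@[simp] theorem lift_gen (f : X → B) (hf : ∀ r ∈ R, FreeStar.lift f r = 0) (x : X) :
    lift h f hf (gen h x) = f x := by
  rw [lift, gen, CStarCompletion.lift_of, FreeStar.lift_gen]

theorem hom_ext {f g : UnivCStar h →⋆ₐ[ℂ] B} (hfg : ∀ x, f (gen h x) = g (gen h x)) : f = g :=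
  CStarCompletion.hom_ext _ fun a =>
    FreeStar.hom_ext (f := f.comp (CStarCompletion.of _)) (g := g.comp (CStarCompletion.of _))
      hfg a

end UnivCStar

end Universal

/-! ### The spatial tensor product -/

section Spatial

universe w

/-- A unital representation of a C*-algebra on a Hilbert space. -/
structure Rep (A : Type w) [CStarAlgebra A] where
  H : Type w
  [normed : NormedAddCommGroup H]
  [inner : InnerProductSpace ℂ H]
  [complete : CompleteSpace H]
  hom : A →⋆ₐ[ℂ] (H →L[ℂ] H)

attribute [instance] Rep.normed Rep.inner Rep.complete

/-- Restriction of a representation along a `*`-homomorphism. -/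
def Rep.comap {A B : Type w} [CStarAlgebra A] [CStarAlgebra B] (f : A →⋆ₐ[ℂ] B) (ρ : Rep B) :
    Rep A where
  H := ρ.H
  hom := ρ.hom.comp f

variable {A B : Type w} [CStarAlgebra A] [CStarAlgebra B]

/-- The representation `a ⊗ b ↦ ρ(a) ⊗ σ(b)` of the algebraic tensor product by bounded operators
on the tensor product of the Hilbert spaces. (Completing the latter does not change operator
norms.) -/
def tensorRep (ρ : Rep A) (σ : Rep B) :
    A ⊗[ℂ] B →ₐ[ℂ] (ρ.H ⊗[ℂ] σ.H →L[ℂ] ρ.H ⊗[ℂ] σ.H) :=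
  Algebra.TensorProduct.lift
    (AlgHom.ofLinearMap
      { toFun := fun a => TensorProduct.mapL (ρ.hom a) (1 : σ.H →L[ℂ] σ.H)
        map_add' := fun a b => by rw [map_add, TensorProduct.mapL_add_left]
        map_smul' := fun c a => by rw [map_smul, TensorProduct.mapL_smul_left]; rfl }
      (by rw [LinearMap.coe_mk, AddHom.coe_mk, map_one]; exact TensorProduct.mapL_id_id)
      (fun a b => by
        simp only [LinearMap.coe_mk, AddHom.coe_mk]
        rw [map_mul, ← TensorProduct.mapL_mul, one_mul]))
    (AlgHom.ofLinearMap
      { toFun := fun b => TensorProduct.mapL (1 : ρ.H →L[ℂ] ρ.H) (σ.hom b)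
        map_add' := fun a b => by rw [map_add, TensorProduct.mapL_add_right]
        map_smul' := fun c a => by rw [map_smul, TensorProduct.mapL_smul_right]; rfl }
      (by rw [LinearMap.coe_mk, AddHom.coe_mk, map_one]; exact TensorProduct.mapL_id_id)
      (fun a b => by
        simp only [LinearMap.coe_mk, AddHom.coe_mk]
        rw [map_mul, ← TensorProduct.mapL_mul, one_mul]))
    (fun a b => by
      change TensorProduct.mapL (ρ.hom a) 1 * TensorProduct.mapL 1 (σ.hom b) =
        TensorProduct.mapL 1 (σ.hom b) * TensorProduct.mapL (ρ.hom a) 1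
      rw [← TensorProduct.mapL_mul, ← TensorProduct.mapL_mul, one_mul, mul_one, one_mul, mul_one])

theorem tensorRep_tmul (ρ : Rep A) (σ : Rep B) (a : A) (b : B) :
    tensorRep ρ σ (a ⊗ₜ b) = TensorProduct.mapL (ρ.hom a) (σ.hom b) := by
  rw [tensorRep, Algebra.TensorProduct.lift_tmul]
  change TensorProduct.mapL (ρ.hom a) 1 * TensorProduct.mapL 1 (σ.hom b) = _
  rw [← TensorProduct.mapL_mul, one_mul, mul_one]

theorem inner_tensorRep_star (ρ : Rep A) (σ : Rep B) (t : A ⊗[ℂ] B) (x y : ρ.H ⊗[ℂ] σ.H) :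
    ⟪tensorRep ρ σ (star t) x, y⟫_ℂ = ⟪x, tensorRep ρ σ t y⟫_ℂ := by
  induction t using TensorProduct.induction_on with
  | zero => simp
  | tmul a b =>
    rw [TensorProduct.star_tmul, tensorRep_tmul, tensorRep_tmul]
    induction x using TensorProduct.induction_on with
    | zero => simp
    | tmul x₁ x₂ =>
      induction y using TensorProduct.induction_on with
      | zero => simp
      | tmul y₁ y₂ =>
        rw [TensorProduct.mapL_tmul, TensorProduct.mapL_tmul, TensorProduct.inner_tmul,
          TensorProduct.inner_tmul, map_star, map_star, ContinuousLinearMap.star_eq_adjoint,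
          ContinuousLinearMap.star_eq_adjoint, ContinuousLinearMap.adjoint_inner_left,
          ContinuousLinearMap.adjoint_inner_left]
      | add y y' hy hy' => rw [map_add, inner_add_right, inner_add_right, hy, hy']
    | add x x' hx hx' => rw [map_add, inner_add_left, inner_add_left, hx, hx']
  | add s t hs ht =>
    rw [star_add, map_add, map_add, add_apply, add_apply,
      inner_add_left, inner_add_right, hs, ht]

/-- The C*-seminorm `t ↦ ‖(ρ ⊗ σ)(t)‖`. -/
def tensorSeminorm (ρ : Rep A) (σ : Rep B) : CStarSeminorm (A ⊗[ℂ] B) where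
  toFun t := ‖tensorRep ρ σ t‖
  map_zero' := by rw [map_zero]; exact ContinuousLinearMap.opNorm_zero
  add_le' s t := by rw [map_add]; exact ContinuousLinearMap.opNorm_add_le _ _
  neg' t := by rw [map_neg]; exact ContinuousLinearMap.opNorm_neg _
  smul' c t := by
    rw [map_smul]
    refine le_antisymm (ContinuousLinearMap.opNorm_smul_le _ _) ?_
    rcases eq_or_ne c 0 with rfl | hc
    · rw [norm_zero, zero_mul]; exact ContinuousLinearMap.opNorm_nonneg _
    · have h := ContinuousLinearMap.opNorm_smul_le c⁻¹ (c • tensorRep ρ σ t)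
      rw [inv_smul_smul₀ hc, norm_inv] at h
      rwa [← le_inv_mul_iff₀ (norm_pos_iff.2 hc)]
  mul_le' s t := by rw [map_mul]; exact ContinuousLinearMap.opNorm_comp_le _ _
  cstar' t := by
    have h0 := ContinuousLinearMap.opNorm_nonneg (tensorRep ρ σ (star t * t))
    have h : ‖tensorRep ρ σ t‖ ≤ √‖tensorRep ρ σ (star t * t)‖ := by
      refine ContinuousLinearMap.opNorm_le_bound _ (Real.sqrt_nonneg _) fun x => ?_
      refine le_of_sq_le_sq ?_ (by positivity)
      rw [mul_pow, Real.sq_sqrt h0]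
      have h1 : ⟪tensorRep ρ σ (star t * t) x, x⟫_ℂ =
          ⟪tensorRep ρ σ t x, tensorRep ρ σ t x⟫_ℂ := by
        rw [map_mul, mul_apply_eq_comp, inner_tensorRep_star]
      have h2 : ‖⟪tensorRep ρ σ (star t * t) x, x⟫_ℂ‖ ≤
          ‖tensorRep ρ σ (star t * t) x‖ * ‖x‖ :=
        norm_inner_le_norm (𝕜 := ℂ) (E := ρ.H ⊗[ℂ] σ.H) _ _
      have h3 : ‖⟪tensorRep ρ σ t x, tensorRep ρ σ t x⟫_ℂ‖ = ‖tensorRep ρ σ t x‖ ^ 2 := by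
        have := inner_self_eq_norm_sq_to_K (𝕜 := ℂ) (E := ρ.H ⊗[ℂ] σ.H) (tensorRep ρ σ t x)
        refine (congrArg norm this).trans ?_
        rw [norm_pow, RCLike.norm_ofReal, abs_norm]
      rw [h1, h3] at h2
      refine h2.trans ?_
      calc _ ≤ (‖tensorRep ρ σ (star t * t)‖ * ‖x‖) * ‖x‖ :=
            mul_le_mul_of_nonneg_right (ContinuousLinearMap.le_opNorm _ _) (norm_nonneg _)
        _ = _ := by ring
    calc _ ≤ √‖tensorRep ρ σ (star t * t)‖ * √‖tensorRep ρ σ (star t * t)‖ :=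
          mul_le_mul h h (ContinuousLinearMap.opNorm_nonneg _) (Real.sqrt_nonneg _)
      _ = _ := Real.mul_self_sqrt h0

theorem bddAbove_tensorSeminorm (t : A ⊗[ℂ] B) :
    BddAbove (Set.range fun r : Rep A × Rep B => tensorSeminorm r.1 r.2 t) := by
  induction t using TensorProduct.induction_on with
  | zero =>
    refine ⟨0, ?_⟩
    rintro _ ⟨r, rfl⟩
    exact (map_zero (tensorSeminorm r.1 r.2).toSeminorm).le
  | tmul a b =>
    refine ⟨‖a‖ * ‖b‖, ?_⟩
    rintro _ ⟨r, rfl⟩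
    change ‖tensorRep r.1 r.2 (a ⊗ₜ b)‖ ≤ _
    rw [tensorRep_tmul]
    exact (TensorProduct.norm_mapL_le _ _).trans (mul_le_mul
      (NonUnitalStarAlgHom.norm_apply_le r.1.hom a) (NonUnitalStarAlgHom.norm_apply_le r.2.hom b)
      (norm_nonneg _) (norm_nonneg _))
  | add s t hs ht =>
    obtain ⟨M, hM⟩ := hs
    obtain ⟨N, hN⟩ := ht
    refine ⟨M + N, ?_⟩
    rintro _ ⟨r, rfl⟩
    exact (map_add_le_add (tensorSeminorm r.1 r.2).toSeminorm s t).trans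
      (add_le_add (hM ⟨r, rfl⟩) (hN ⟨r, rfl⟩))

variable (A B) in
/-- The spatial (minimal) C*-norm on the algebraic tensor product. -/
def spatialSeminorm : CStarSeminorm (A ⊗[ℂ] B) :=
  CStarSeminorm.sup (fun r : Rep A × Rep B => tensorSeminorm r.1 r.2) bddAbove_tensorSeminorm

variable (A B) in
/-- The spatial (minimal) tensor product of two unital C*-algebras. -/
abbrev MinTensor : Type w := CStarCompletion (spatialSeminorm A B)

namespace MinTensor

/-- The elementary tensor `a ⊗ b`. -/
def tmul (a : A) (b : B) : MinTensor A B := CStarCompletion.of (spatialSeminorm A B) (a ⊗ₜ b)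

variable {A' B' : Type w} [CStarAlgebra A'] [CStarAlgebra B']

/-- The algebraic tensor product of two `*`-homomorphisms. -/
def algMap (f : A →⋆ₐ[ℂ] A') (g : B →⋆ₐ[ℂ] B') : A ⊗[ℂ] B →⋆ₐ[ℂ] A' ⊗[ℂ] B' where
  __ := Algebra.TensorProduct.map f.toAlgHom g.toAlgHom
  map_star' t := by
    change Algebra.TensorProduct.map f.toAlgHom g.toAlgHom (star t) =
      star (Algebra.TensorProduct.map f.toAlgHom g.toAlgHom t)
    induction t using TensorProduct.induction_on with
    | zero => simp
    | tmul a b => simp [TensorProduct.star_tmul, map_star]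
    | add s t hs ht => rw [star_add, map_add, map_add, star_add, hs, ht]

@[simp] theorem algMap_tmul (f : A →⋆ₐ[ℂ] A') (g : B →⋆ₐ[ℂ] B') (a : A) (b : B) :
    algMap f g (a ⊗ₜ b) = f a ⊗ₜ g b := rfl

theorem tensorRep_algMap (f : A →⋆ₐ[ℂ] A') (g : B →⋆ₐ[ℂ] B') (ρ : Rep A') (σ : Rep B')
    (t : A ⊗[ℂ] B) :
    tensorRep ρ σ (algMap f g t) = tensorRep (ρ.comap f) (σ.comap g) t := by
  induction t using TensorProduct.induction_on with
  | zero => rw [map_zero, map_zero, map_zero]; rfl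
  | tmul a b => rw [algMap_tmul, tensorRep_tmul, tensorRep_tmul]; rfl
  | add s t hs ht => rw [map_add, map_add, map_add, hs, ht]; rfl

theorem norm_of_algMap_le (f : A →⋆ₐ[ℂ] A') (g : B →⋆ₐ[ℂ] B') (t : A ⊗[ℂ] B) :
    ‖((CStarCompletion.of (spatialSeminorm A' B')).comp (algMap f g)) t‖ ≤
      spatialSeminorm A B t := by
  rw [StarAlgHom.comp_apply, CStarCompletion.norm_of]
  refine Real.iSup_le (fun r => ?_) (apply_nonneg (spatialSeminorm A B).toSeminorm t)
  have h : tensorSeminorm r.1 r.2 (algMap f g t) =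
      tensorSeminorm (r.1.comap f) (r.2.comap g) t :=
    congrArg norm (tensorRep_algMap f g r.1 r.2 t)
  rw [h]
  exact CStarSeminorm.le_sup (fun r : Rep A × Rep B => tensorSeminorm r.1 r.2)
    bddAbove_tensorSeminorm (r.1.comap f, r.2.comap g) t

/-- The tensor product `f ⊗ g` of two `*`-homomorphisms. -/
def map (f : A →⋆ₐ[ℂ] A') (g : B →⋆ₐ[ℂ] B') : MinTensor A B →⋆ₐ[ℂ] MinTensor A' B' :=
  CStarCompletion.lift (spatialSeminorm A B)
    ((CStarCompletion.of (spatialSeminorm A' B')).comp (algMap f g)) (norm_of_algMap_le f g)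

theorem map_tmul (f : A →⋆ₐ[ℂ] A') (g : B →⋆ₐ[ℂ] B') (a : A) (b : B) :
    map f g (tmul a b) = tmul (f a) (g b) := by
  rw [map, tmul, CStarCompletion.lift_of]; rfl

theorem tmul_mul (a a' : A) (b b' : B) : tmul a b * tmul a' b' = tmul (a * a') (b * b') := by
  rw [tmul, tmul, ← map_mul, Algebra.TensorProduct.tmul_mul_tmul]; rfl

theorem star_tmul (a : A) (b : B) : star (tmul a b) = tmul (star a) (star b) := by
  rw [tmul, ← map_star, TensorProduct.star_tmul]; rfl

theorem one_def : (1 : MinTensor A B) = tmul 1 1 := by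
  rw [tmul, ← Algebra.TensorProduct.one_def, map_one]

theorem sum_tmul {ι : Type*} (s : Finset ι) (a : ι → A) (b : B) :
    tmul (∑ i ∈ s, a i) b = ∑ i ∈ s, tmul (a i) b := by
  rw [tmul, TensorProduct.sum_tmul, map_sum]; rfl

theorem tmul_sum {ι : Type*} (s : Finset ι) (a : A) (b : ι → B) :
    tmul a (∑ i ∈ s, b i) = ∑ i ∈ s, tmul a (b i) := by
  rw [tmul, TensorProduct.tmul_sum, map_sum]; rfl

theorem smul_tmul (c : ℂ) (a : A) (b : B) : tmul (c • a) b = c • tmul a b := by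
  rw [tmul, ← TensorProduct.smul_tmul', map_smul]; rfl

theorem tmul_smul (c : ℂ) (a : A) (b : B) : tmul a (c • b) = c • tmul a b := by
  rw [tmul, TensorProduct.tmul_smul, map_smul]; rfl

theorem zero_tmul (b : B) : tmul (0 : A) b = 0 := by
  rw [tmul, TensorProduct.zero_tmul, map_zero]

theorem tmul_zero (a : A) : tmul a (0 : B) = 0 := by
  rw [tmul, TensorProduct.tmul_zero, map_zero]

end MinTensor

end Spatial

/-! ### Free orthogonal quantum groups and their braided versions -/

section UnitaryMatrix

theorem norm_le_one_of_isometry {B : Type*} [CStarAlgebra B] {n : ℕ} {a : Fin n → B}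
    (h : ∑ k, star (a k) * a k = 1) (k : Fin n) : ‖a k‖ ≤ 1 := by
  let _ := CStarAlgebra.spectralOrder B
  have _ := CStarAlgebra.spectralOrderedRing B
  have h1 : star (a k) * a k ≤ 1 := by
    rw [← h]
    exact Finset.single_le_sum (f := fun k => star (a k) * a k)
      (fun i _ => star_mul_self_nonneg (a i)) (Finset.mem_univ k)
  have h2 := (CStarAlgebra.norm_le_one_iff_of_nonneg _ (star_mul_self_nonneg (a k))).2 h1
  rw [CStarRing.norm_star_mul_self] at h2
  nlinarith [norm_nonneg (a k)]

open FreeStar (gen)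

/-- The relations saying that a matrix `(x i j)` of noncommuting variables is unitary. -/
inductive UnitaryRel (n : ℕ) : FreeStar (Fin n × Fin n) → Prop
  | isometry (i j : Fin n) :
      UnitaryRel n (∑ k, star (gen (k, i)) * gen (k, j) - if i = j then 1 else 0)
  | coisometry (i j : Fin n) :
      UnitaryRel n (∑ k, gen (i, k) * star (gen (j, k)) - if i = j then 1 else 0)

theorem boundedRel_of_unitaryRel {n : ℕ} {R : Set (FreeStar (Fin n × Fin n))}
    (hR : ∀ r, UnitaryRel n r → r ∈ R) : BoundedRel R := by
  refine BoundedRel.of_rep fun x => ⟨1, fun B _ f hf => ?_⟩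
  have h := hf _ (hR _ (UnitaryRel.isometry x.2 x.2))
  simp only [if_true, map_sub, map_sum, map_mul, map_star, map_one, sub_eq_zero] at h
  exact norm_le_one_of_isometry h x.1

theorem lift_isometry {B : Type*} [Ring B] [StarRing B] [Algebra ℂ B] [StarModule ℂ B] {n : ℕ}
    (f : Fin n × Fin n → B) (i j : Fin n) :
    FreeStar.lift f (∑ k, star (gen (k, i)) * gen (k, j) - if i = j then 1 else 0) = 0 ↔
      ∑ k, star (f (k, i)) * f (k, j) = if i = j then 1 else 0 := by
  split_ifs <;>
  simp only [map_sub, map_sum, map_mul, map_star, map_one, map_zero, FreeStar.lift_gen,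
    sub_eq_zero]

theorem lift_coisometry {B : Type*} [Ring B] [StarRing B] [Algebra ℂ B] [StarModule ℂ B] {n : ℕ}
    (f : Fin n × Fin n → B) (i j : Fin n) :
    FreeStar.lift f (∑ k, gen (i, k) * star (gen (j, k)) - if i = j then 1 else 0) = 0 ↔
      ∑ k, f (i, k) * star (f (j, k)) = if i = j then 1 else 0 := by
  split_ifs <;>
  simp only [map_sub, map_sum, map_mul, map_star, map_one, map_zero, FreeStar.lift_gen,
    sub_eq_zero]

end UnitaryMatrix

open FreeStar (gen)

section Ao

variable {n : ℕ} (F : Matrix (Fin n) (Fin n) ℂ)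

/-- The relations of `A_o(F)`: the matrix `x` is unitary and `x F = F x̄`. -/
inductive AoRel : FreeStar (Fin n × Fin n) → Prop
  | unitary (r) : UnitaryRel n r → AoRel r
  | intertwiner (i j : Fin n) :
      AoRel (∑ k, F k j • gen (i, k) - ∑ k, F i k • star (gen (k, j)))

theorem boundedRel_Ao : BoundedRel {r | AoRel F r} :=
  boundedRel_of_unitaryRel fun r hr => AoRel.unitary r hr

/-- The C*-algebra `A_o(F)` of the free orthogonal quantum group. -/
abbrev Ao : Type := UnivCStar (boundedRel_Ao F)

namespace Ao

/-- The generators of `A_o(F)`. -/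
def x (i j : Fin n) : Ao F := UnivCStar.gen (boundedRel_Ao F) (i, j)

theorem isometry (i j : Fin n) : ∑ k, star (x F k i) * x F k j = if i = j then 1 else 0 :=
  (lift_isometry _ i j).1 (UnivCStar.lift_gen_rel (boundedRel_Ao F)
    (AoRel.unitary _ (UnitaryRel.isometry i j)))

theorem coisometry (i j : Fin n) : ∑ k, x F i k * star (x F j k) = if i = j then 1 else 0 :=
  (lift_coisometry _ i j).1 (UnivCStar.lift_gen_rel (boundedRel_Ao F)
    (AoRel.unitary _ (UnitaryRel.coisometry i j)))

theorem intertwiner (i j : Fin n) :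
    ∑ k, F k j • x F i k = ∑ k, F i k • star (x F k j) := by
  have h := UnivCStar.lift_gen_rel (boundedRel_Ao F) (AoRel.intertwiner i j)
  simp only [map_sub, map_sum, map_smul, map_star, FreeStar.lift_gen, sub_eq_zero] at h
  exact h

variable {F} {B : Type*} [CStarAlgebra B]

/-- The universal property of `A_o(F)`. -/
def lift (y : Fin n → Fin n → B)
    (h₁ : ∀ i j, ∑ k, star (y k i) * y k j = if i = j then 1 else 0)
    (h₂ : ∀ i j, ∑ k, y i k * star (y j k) = if i = j then 1 else 0)
    (h₃ : ∀ i j, ∑ k, F k j • y i k = ∑ k, F i k • star (y k j)) : Ao F →⋆ₐ[ℂ] B :=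
  UnivCStar.lift (boundedRel_Ao F) (fun p => y p.1 p.2) (by
    intro r hr
    cases hr with
    | unitary _ hr =>
      cases hr with
      | isometry i j => exact (lift_isometry _ i j).2 (h₁ i j)
      | coisometry i j => exact (lift_coisometry _ i j).2 (h₂ i j)
    | intertwiner i j =>
      simpa only [map_sub, map_sum, map_smul, map_star, FreeStar.lift_gen, sub_eq_zero]
        using h₃ i j)

@[simp] theorem lift_x (y : Fin n → Fin n → B)
    (h₁ : ∀ i j, ∑ k, star (y k i) * y k j = if i = j then 1 else 0)
    (h₂ : ∀ i j, ∑ k, y i k * star (y j k) = if i = j then 1 else 0)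
    (h₃ : ∀ i j, ∑ k, F k j • y i k = ∑ k, F i k • star (y k j)) (i j : Fin n) :
    lift y h₁ h₂ h₃ (x F i j) = y i j :=
  UnivCStar.lift_gen _ _ _ _

theorem hom_ext {f g : Ao F →⋆ₐ[ℂ] B} (h : ∀ i j, f (x F i j) = g (x F i j)) : f = g :=
  UnivCStar.hom_ext _ fun p => h p.1 p.2

section Comul

theorem comul_isometry (i j : Fin n) :
    ∑ k, star (∑ l, MinTensor.tmul (x F k l) (x F l i)) *
      (∑ m, MinTensor.tmul (x F k m) (x F m j)) = if i = j then 1 else 0 := by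
  simp only [star_sum, MinTensor.star_tmul, Finset.sum_mul, Finset.mul_sum, MinTensor.tmul_mul]
  calc _ = ∑ l, ∑ m, MinTensor.tmul (∑ k, star (x F k l) * x F k m)
          (star (x F l i) * x F m j) := by
        simp only [MinTensor.sum_tmul]
        rw [Finset.sum_congr rfl fun k _ => Finset.sum_comm, Finset.sum_comm]
        exact Finset.sum_congr rfl fun l _ => Finset.sum_comm
    _ = ∑ l, MinTensor.tmul 1 (star (x F l i) * x F l j) := by
        refine Finset.sum_congr rfl fun l _ => ?_
        rw [Finset.sum_eq_single l, isometry, if_pos rfl]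
        · intro m _ hm
          rw [isometry, if_neg hm.symm, MinTensor.zero_tmul]
        · exact fun h => absurd (Finset.mem_univ l) h
    _ = _ := by
        rw [← MinTensor.tmul_sum, isometry]
        split_ifs
        · exact MinTensor.one_def.symm
        · exact MinTensor.tmul_zero 1

theorem comul_coisometry (i j : Fin n) :
    ∑ k, (∑ l, MinTensor.tmul (x F i l) (x F l k)) *
      star (∑ m, MinTensor.tmul (x F j m) (x F m k)) = if i = j then 1 else 0 := by
  simp only [star_sum, MinTensor.star_tmul, Finset.sum_mul, Finset.mul_sum, MinTensor.tmul_mul]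
  calc _ = ∑ l, ∑ m, MinTensor.tmul (x F i l * star (x F j m))
          (∑ k, x F l k * star (x F m k)) := by
        simp only [MinTensor.tmul_sum]
        rw [Finset.sum_congr rfl fun k _ => Finset.sum_comm, Finset.sum_comm]
        exact Finset.sum_congr rfl fun l _ => Finset.sum_comm
    _ = ∑ l, MinTensor.tmul (x F i l * star (x F j l)) 1 := by
        refine Finset.sum_congr rfl fun l _ => ?_
        rw [Finset.sum_eq_single l, coisometry, if_pos rfl]
        · intro m _ hm
          rw [coisometry, if_neg hm.symm, MinTensor.tmul_zero]
        · exact fun h => absurd (Finset.mem_univ l) h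
    _ = _ := by
        rw [← MinTensor.sum_tmul, coisometry]
        split_ifs
        · exact MinTensor.one_def.symm
        · exact MinTensor.zero_tmul 1

theorem comul_intertwiner (i j : Fin n) :
    ∑ k, F k j • ∑ l, MinTensor.tmul (x F i l) (x F l k) =
      ∑ k, F i k • star (∑ l, MinTensor.tmul (x F k l) (x F l j)) := by
  simp only [star_sum, MinTensor.star_tmul]
  calc _ = ∑ l, MinTensor.tmul (x F i l) (∑ k, F k j • x F l k) := by
        simp only [MinTensor.tmul_sum, MinTensor.tmul_smul, Finset.smul_sum]
        exact Finset.sum_comm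
    _ = ∑ k, MinTensor.tmul (∑ l, F l k • x F i l) (star (x F k j)) := by
        simp only [intertwiner F _ j, MinTensor.tmul_sum, MinTensor.tmul_smul,
          MinTensor.sum_tmul, MinTensor.smul_tmul]
        exact Finset.sum_comm
    _ = _ := by
        simp only [intertwiner F i, MinTensor.sum_tmul, MinTensor.smul_tmul, Finset.smul_sum]
        exact Finset.sum_comm

variable (F) in
/-- The comultiplication of `A_o(F)`, given by `x i j ↦ ∑ k, x i k ⊗ x k j`. -/
def comul : Ao F →⋆ₐ[ℂ] MinTensor (Ao F) (Ao F) :=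
  lift (fun i j => ∑ k, MinTensor.tmul (x F i k) (x F k j))
    comul_isometry comul_coisometry comul_intertwiner

theorem comul_x (i j : Fin n) :
    comul F (x F i j) = ∑ k, MinTensor.tmul (x F i k) (x F k j) := lift_x _ _ _ _ i j

end Comul

end Ao

end Ao

section Twist

variable {n : ℕ} {B : Type*} [CStarAlgebra B] {w : Fin n → Fin n → Circle}

theorem twist_isometry (hw : ∀ i j k, w i j * w j k = w i k) {y : Fin n → Fin n → B}
    (h : ∀ i j, ∑ k, star (y k i) * y k j = if i = j then 1 else 0) (i j : Fin n) :
    ∑ k, star ((w k i : ℂ) • y k i) * ((w k j : ℂ) • y k j) = if i = j then 1 else 0 := by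
  have h1 : ∀ k, star ((w k i : ℂ) • y k i) * ((w k j : ℂ) • y k j) =
      (w i j : ℂ) • (star (y k i) * y k j) := fun k => by
    rw [star_smul, smul_mul_smul_comm, ← hw k i j, Circle.coe_mul, ← mul_assoc]
    congr 1
    rw [Complex.star_def, Complex.conj_mul', Circle.norm_coe]; simp
  rw [Finset.sum_congr rfl fun k _ => h1 k, ← Finset.smul_sum, h]
  split_ifs with hij
  · subst hij
    have : w i i = 1 := by simpa using hw i i i
    rw [this, Circle.coe_one, one_smul]
  · exact smul_zero _

theorem twist_coisometry (hw : ∀ i j k, w i j * w j k = w i k) {y : Fin n → Fin n → B}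
    (h : ∀ i j, ∑ k, y i k * star (y j k) = if i = j then 1 else 0) (i j : Fin n) :
    ∑ k, ((w i k : ℂ) • y i k) * star ((w j k : ℂ) • y j k) = if i = j then 1 else 0 := by
  have h1 : ∀ k, ((w i k : ℂ) • y i k) * star ((w j k : ℂ) • y j k) =
      (w i j : ℂ) • (y i k * star (y j k)) := fun k => by
    rw [star_smul, smul_mul_smul_comm, ← hw i j k, Circle.coe_mul, mul_assoc]
    congr 1
    rw [Complex.star_def, Complex.mul_conj', Circle.norm_coe]; simp
  rw [Finset.sum_congr rfl fun k _ => h1 k, ← Finset.smul_sum, h]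
  split_ifs with hij
  · subst hij
    have : w i i = 1 := by simpa using hw i i i
    rw [this, Circle.coe_one, one_smul]
  · exact smul_zero _

end Twist

namespace Ao

variable {n : ℕ} {F : Matrix (Fin n) (Fin n) ℂ}

/-- The `*`-endomorphism `x i j ↦ ζ ^ (d i - d j) • x i j` of `A_o(F)`. -/
def twistHom (ζ : Circle) (d : Fin n → ℤ) (hF : ∀ i j, F i j ≠ 0 → d i + d j = 0) :
    Ao F →⋆ₐ[ℂ] Ao F :=
  lift (fun i j => ((ζ ^ (d i - d j) : Circle) : ℂ) • x F i j)
    (twist_isometry (fun i j k => by rw [← zpow_add]; congr 1; ring) (isometry F))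
    (twist_coisometry (fun i j k => by rw [← zpow_add]; congr 1; ring) (coisometry F))
    (fun i j => by
      have h1 : ∀ k, F k j • ((ζ ^ (d i - d k) : Circle) : ℂ) • x F i k =
          ((ζ ^ (d i + d j) : Circle) : ℂ) • F k j • x F i k := fun k => by
        by_cases hk : F k j = 0
        · rw [hk, zero_smul, zero_smul, smul_zero]
        · rw [smul_comm, show d i - d k = d i + d j by have := hF k j hk; lia]
      have h2 : ∀ k, F i k • star (((ζ ^ (d k - d j) : Circle) : ℂ) • x F k j) =
          ((ζ ^ (d i + d j) : Circle) : ℂ) • F i k • star (x F k j) := fun k => by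
        by_cases hk : F i k = 0
        · rw [hk, zero_smul, zero_smul, smul_zero]
        · rw [star_smul, Complex.star_def, ← Circle.coe_inv_eq_conj, ← zpow_neg, smul_comm,
            show -(d k - d j) = d i + d j by have := hF i k hk; lia]
      simp only [h1, h2]
      rw [← Finset.smul_sum, ← Finset.smul_sum, intertwiner])

@[simp] theorem twistHom_x (ζ : Circle) (d : Fin n → ℤ)
    (hF : ∀ i j, F i j ≠ 0 → d i + d j = 0) (i j : Fin n) :
    twistHom ζ d hF (x F i j) = ((ζ ^ (d i - d j) : Circle) : ℂ) • x F i j := lift_x _ _ _ _ i j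

theorem twistHom_inv_comp (ζ : Circle) (d : Fin n → ℤ) (hF : ∀ i j, F i j ≠ 0 → d i + d j = 0) :
    (twistHom ζ⁻¹ d hF).comp (twistHom ζ d hF) = StarAlgHom.id ℂ (Ao F) :=
  hom_ext fun i j => by
    rw [StarAlgHom.comp_apply, twistHom_x, map_smul, twistHom_x, smul_smul, ← Circle.coe_mul,
      ← mul_zpow, mul_inv_cancel, one_zpow, Circle.coe_one, one_smul]; rfl

/-- The `*`-automorphism `x i j ↦ ζ ^ (d i - d j) • x i j` of `A_o(F)`. -/
def twist (ζ : Circle) (d : Fin n → ℤ) (hF : ∀ i j, F i j ≠ 0 → d i + d j = 0) :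
    Ao F ≃⋆ₐ[ℂ] Ao F :=
  StarAlgEquiv.ofStarAlgHom (twistHom ζ d hF) (twistHom ζ⁻¹ d hF)
    (twistHom_inv_comp ζ d hF) (by simpa using twistHom_inv_comp ζ⁻¹ d hF)

@[simp] theorem twist_x (ζ : Circle) (d : Fin n → ℤ)
    (hF : ∀ i j, F i j ≠ 0 → d i + d j = 0) (i j : Fin n) :
    twist ζ d hF (x F i j) = ((ζ ^ (d i - d j) : Circle) : ℂ) • x F i j :=
  twistHom_x ζ d hF i j

end Ao

/-! ### The crossed product by an automorphism -/

section Crossed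

variable {A : Type*} [CStarAlgebra A] (α : A ≃⋆ₐ[ℂ] A)

/-- The relations of the crossed product `A ⋊_α ℤ`. The generators are `some a` for `a` in `A` and
the variable `none`. The relations say that `a ↦ some a` is a unital `*`-homomorphism, that the
variable `none` is unitary, and that conjugation by it implements `α`. -/
inductive CrossedRel : FreeStar (Option A) → Prop
  | add (a b : A) : CrossedRel (gen (some (a + b)) - (gen (some a) + gen (some b)))
  | smul (c : ℂ) (a : A) : CrossedRel (gen (some (c • a)) - c • gen (some a))
  | mul (a b : A) : CrossedRel (gen (some (a * b)) - gen (some a) * gen (some b))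
  | one : CrossedRel (gen (some 1) - 1)
  | star (a : A) : CrossedRel (gen (some (star a)) - star (gen (some a)))
  | isometry : CrossedRel (star (gen none) * gen none - 1)
  | coisometry : CrossedRel (gen none * star (gen none) - 1)
  | covariance (a : A) :
      CrossedRel (gen none * gen (some a) * star (gen none) - gen (some (α a)))

/-- A function that satisfies the relations of the crossed product is a `*`-homomorphism on `A`. -/
def crossedHom {B : Type*} [Ring B] [StarRing B] [Algebra ℂ B] (f : FreeStar (Option A) →⋆ₐ[ℂ] B)
    (hf : ∀ r, CrossedRel α r → f r = 0) : A →⋆ₐ[ℂ] B where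
  toFun a := f (gen (some a))
  map_one' := by simpa only [map_sub, map_one, sub_eq_zero] using hf _ CrossedRel.one
  map_mul' a b := by simpa only [map_sub, map_mul, sub_eq_zero] using hf _ (CrossedRel.mul a b)
  map_zero' := by
    simpa only [zero_smul, sub_zero] using hf _ (CrossedRel.smul 0 0)
  map_add' a b := by simpa only [map_sub, map_add, sub_eq_zero] using hf _ (CrossedRel.add a b)
  commutes' c := by
    have h := hf _ (CrossedRel.smul c 1)
    have h1 := hf _ CrossedRel.one
    simp only [map_sub, map_smul, map_one, sub_eq_zero] at h h1
    rw [Algebra.algebraMap_eq_smul_one, h, h1, Algebra.algebraMap_eq_smul_one]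
  map_star' a := by simpa only [map_sub, map_star, sub_eq_zero] using hf _ (CrossedRel.star a)

theorem boundedRel_crossed : BoundedRel {r | CrossedRel α r} := by
  refine BoundedRel.of_rep fun x => ?_
  rcases x with _ | a
  · refine ⟨1, fun B _ f hf => ?_⟩
    have h := hf _ CrossedRel.isometry
    simp only [map_sub, map_mul, map_star, map_one, sub_eq_zero] at h
    have := norm_le_one_of_isometry (n := 1) (a := fun _ => f (gen none)) (by simpa using h) 0
    exact this
  · exact ⟨‖a‖, fun B _ f hf => NonUnitalStarAlgHom.norm_apply_le (crossedHom α f hf) a⟩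

/-- The crossed product C*-algebra `A ⋊_α ℤ`. -/
abbrev Crossed : Type _ := UnivCStar (boundedRel_crossed α)

namespace Crossed

/-- The canonical `*`-homomorphism `A → A ⋊_α ℤ`. -/
def incl : A →⋆ₐ[ℂ] Crossed α :=
  crossedHom α (CStarCompletion.of (univSeminorm (boundedRel_crossed α)))
    fun _ hr => UnivCStar.of_rel (boundedRel_crossed α) hr

/-- The canonical unitary in `A ⋊_α ℤ` that implements `α`. -/
def z : Crossed α := UnivCStar.gen (boundedRel_crossed α) none

end Crossed

end Crossed

/-! ### Braided free orthogonal quantum groups -/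

/-- The data that define a braided free orthogonal quantum group over the circle: the
representation of the circle on `ℂⁿ` given by `π_z(e_i) = z ^ (deg i) e_i`, and a `d`-homogeneous
vector `∑ i j, Ω i j • (e_i ⊗ e_j)` such that `Ω̄ Ω = c • π_{ζ ^ d}` for some nonzero scalar `c`. -/
structure BraidedData (ζ : Circle) where
  n : ℕ
  deg : Fin n → ℤ
  d : ℤ
  Ω : Matrix (Fin n) (Fin n) ℂ
  homogeneous : ∀ i j, Ω i j ≠ 0 → deg i + deg j = d
  condition : ∃ c : ℂ, c ≠ 0 ∧
    Ω.map star * Ω = c • Matrix.diagonal fun i => ((ζ ^ (d * deg i) : Circle) : ℂ)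

section Braided

variable {ζ : Circle} (D : BraidedData ζ)

/-- The relations of `A_o(V, π, ω)`. -/
inductive BraidedAoRel : FreeStar (Fin D.n × Fin D.n) → Prop
  | unitary (r) : UnitaryRel D.n r → BraidedAoRel r
  | invariant (i j : Fin D.n) :
      BraidedAoRel (((ζ ^ (D.deg j * D.deg i) : Circle) : ℂ) • ∑ k, D.Ω i k • gen (j, k) -
        ((ζ ^ (D.deg j * (D.d - D.deg j)) : Circle) : ℂ) • ∑ k, D.Ω k j • star (gen (k, i)))

theorem boundedRel_braidedAo : BoundedRel {r | BraidedAoRel D r} :=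
  boundedRel_of_unitaryRel fun r hr => BraidedAoRel.unitary r hr

/-- The underlying C*-algebra of the braided free orthogonal quantum group. -/
abbrev BraidedAo : Type := UnivCStar (boundedRel_braidedAo D)

namespace BraidedAo

/-- The generators of the braided free orthogonal quantum group. -/
def u (i j : Fin D.n) : BraidedAo D := UnivCStar.gen (boundedRel_braidedAo D) (i, j)

theorem isometry (i j : Fin D.n) : ∑ k, star (u D k i) * u D k j = if i = j then 1 else 0 :=
  (lift_isometry _ i j).1 (UnivCStar.lift_gen_rel (boundedRel_braidedAo D)
    (BraidedAoRel.unitary _ (UnitaryRel.isometry i j)))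

theorem coisometry (i j : Fin D.n) : ∑ k, u D i k * star (u D j k) = if i = j then 1 else 0 :=
  (lift_coisometry _ i j).1 (UnivCStar.lift_gen_rel (boundedRel_braidedAo D)
    (BraidedAoRel.unitary _ (UnitaryRel.coisometry i j)))

theorem invariant (i j : Fin D.n) :
    ((ζ ^ (D.deg j * D.deg i) : Circle) : ℂ) • ∑ k, D.Ω i k • u D j k =
      ((ζ ^ (D.deg j * (D.d - D.deg j)) : Circle) : ℂ) • ∑ k, D.Ω k j • star (u D k i) := by
  have h := UnivCStar.lift_gen_rel (boundedRel_braidedAo D) (BraidedAoRel.invariant i j)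
  simp only [map_sub, map_sum, map_smul, map_star, FreeStar.lift_gen, sub_eq_zero] at h
  exact h

/-- The action `β` of the circle, given by `β_z(u i k) = z ^ (deg k - deg i) • u i k`. -/
def action (z : Circle) : BraidedAo D →⋆ₐ[ℂ] BraidedAo D :=
  UnivCStar.lift (boundedRel_braidedAo D)
    (fun p => ((z ^ (D.deg p.2 - D.deg p.1) : Circle) : ℂ) • u D p.1 p.2) (by
      intro r hr
      have hw : ∀ i j k : Fin D.n, z ^ (D.deg j - D.deg i) * z ^ (D.deg k - D.deg j) =
          z ^ (D.deg k - D.deg i) := fun i j k => by rw [← zpow_add]; congr 1; ring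
      cases hr with
      | unitary _ hr =>
        cases hr with
        | isometry i j => exact (lift_isometry _ i j).2 (twist_isometry hw (isometry D) i j)
        | coisometry i j =>
          exact (lift_coisometry _ i j).2 (twist_coisometry hw (coisometry D) i j)
      | invariant i j =>
        simp only [map_sub, map_sum, map_smul, map_star, FreeStar.lift_gen, sub_eq_zero]
        have h1 : ∀ k, D.Ω i k • ((z ^ (D.deg k - D.deg j) : Circle) : ℂ) • u D j k =
            ((z ^ (D.d - D.deg i - D.deg j) : Circle) : ℂ) • D.Ω i k • u D j k := fun k => by
          by_cases hk : D.Ω i k = 0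
          · rw [hk, zero_smul, zero_smul, smul_zero]
          · rw [smul_comm, show D.deg k - D.deg j = D.d - D.deg i - D.deg j by
              have := D.homogeneous i k hk; lia]
        have h2 : ∀ k, D.Ω k j • star (((z ^ (D.deg i - D.deg k) : Circle) : ℂ) • u D k i) =
            ((z ^ (D.d - D.deg i - D.deg j) : Circle) : ℂ) • D.Ω k j • star (u D k i) :=
          fun k => by
          by_cases hk : D.Ω k j = 0
          · rw [hk, zero_smul, zero_smul, smul_zero]
          · rw [star_smul, Complex.star_def, ← Circle.coe_inv_eq_conj, ← zpow_neg, smul_comm,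
              show -(D.deg i - D.deg k) = D.d - D.deg i - D.deg j by
                have := D.homogeneous k j hk; lia]
        simp only [h1, h2]
        rw [← Finset.smul_sum, ← Finset.smul_sum, smul_comm, invariant, smul_comm])

@[simp] theorem action_u (z : Circle) (i k : Fin D.n) :
    action D z (u D i k) = ((z ^ (D.deg k - D.deg i) : Circle) : ℂ) • u D i k :=
  UnivCStar.lift_gen _ _ _ _

end BraidedAo

/-! ### The bosonisation -/

/-- A faithful, equivariant representation of `A_o(V, π, ω)` on a Hilbert space `L` with a
continuous unitary representation of the circle. -/
structure EquivariantRep where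
  L : Type
  [normed : NormedAddCommGroup L]
  [inner : InnerProductSpace ℂ L]
  [complete : CompleteSpace L]
  U : Circle →* unitary (L →L[ℂ] L)
  continuous_U : ∀ v : L, Continuous fun z => (U z : L →L[ℂ] L) v
  hom : BraidedAo D →⋆ₐ[ℂ] (L →L[ℂ] L)
  injective : Function.Injective hom
  equivariant : ∀ (z : Circle) (b : BraidedAo D),
    hom (BraidedAo.action D z b) = U z * hom b * star (U z : L →L[ℂ] L)

attribute [instance] EquivariantRep.normed EquivariantRep.inner EquivariantRep.complete

end Braided

section SequenceSpace

variable (L : Type) [NormedAddCommGroup L] [InnerProductSpace ℂ L]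

/-- The Hilbert space `ℓ²(ℤ, L)`, which is `L²(𝕋) ⊗ L` by Fourier transform: the sequence that
is `v` at `k` and zero elsewhere corresponds to `z ^ k ⊗ v`. -/
abbrev Seq : Type := lp (fun _ : ℤ => L) 2

variable {L}

/-- The operator `z ^ k ⊗ v ↦ z ^ k ⊗ T k v` for a bounded sequence of operators `T k`. -/
def diagOp (T : ℤ → L →L[ℂ] L) (M : ℝ) (hT : ∀ k, ‖T k‖ ≤ M) : Seq L →L[ℂ] Seq L :=
  have hM : 0 ≤ M := (norm_nonneg _).trans (hT 0)
  have hle : ∀ (f : Seq L) (k : ℤ), ‖T k (f k)‖ ≤ ‖((M : ℂ) • f) k‖ := fun f k => by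
    rw [lp.coeFn_smul, Pi.smul_apply, norm_smul, Complex.norm_real, Real.norm_of_nonneg hM]
    exact (T k).le_of_opNorm_le (hT k) _
  LinearMap.mkContinuous
    { toFun := fun f => ⟨fun k => T k (f k), (lp.memℓp ((M : ℂ) • f)).mono' (hle f)⟩
      map_add' := fun f g => by ext k; exact map_add (T k) (f k) (g k)
      map_smul' := fun c f => by ext k; exact map_smul (T k) c (f k) } M fun f => by
    refine (lp.norm_mono two_ne_zero (y := (M : ℂ) • f) (hle f)).trans_eq ?_
    rw [norm_smul, Complex.norm_real, Real.norm_of_nonneg hM]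

@[simp] theorem diagOp_apply (T : ℤ → L →L[ℂ] L) (M : ℝ) (hT : ∀ k, ‖T k‖ ≤ M) (f : Seq L)
    (k : ℤ) : diagOp T M hT f k = T k (f k) := rfl

/-- The shift `z ^ k ⊗ v ↦ z ^ (k + m) ⊗ v`, that is, multiplication by `z ^ m`. -/
def shiftIsometry (m : ℤ) : Seq L →ₗᵢ[ℂ] Seq L where
  toFun f := ⟨fun k => f (k - m), memℓp_gen
    (((lp.memℓp f).summable (by norm_num)).comp_injective (sub_left_injective (b := m)))⟩
  map_add' f g := rfl
  map_smul' c f := rfl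
  norm_map' f := by
    have h2 : 0 < (2 : ENNReal).toReal := by norm_num
    rw [lp.norm_eq_tsum_rpow h2, lp.norm_eq_tsum_rpow h2]
    congr 1
    exact (Equiv.subRight m).tsum_eq fun k => ‖f k‖ ^ (2 : ENNReal).toReal

/-- The unitary operator of multiplication by the coordinate function `z`, that is,
`z ^ k ⊗ v ↦ z ^ (k + 1) ⊗ v`. -/
def shift : Seq L ≃ₗᵢ[ℂ] Seq L where
  __ := (shiftIsometry 1 : Seq L →ₗᵢ[ℂ] Seq L)
  invFun := shiftIsometry (-1)
  left_inv f := by ext k; exact congrArg f (by ring)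
  right_inv f := by ext k; exact congrArg f (by ring)

theorem shift_apply (f : Seq L) (k : ℤ) : shift f k = f (k - 1) := rfl

end SequenceSpace

section Bosonisation

variable {ζ : Circle} {D : BraidedData ζ} (R : EquivariantRep D)

namespace EquivariantRep

theorem norm_U_le (z : Circle) : ‖(R.U z : R.L →L[ℂ] R.L)‖ ≤ 1 :=
  ContinuousLinearMap.opNorm_le_bound _ zero_le_one fun v => by
    rw [one_mul]; exact (Unitary.norm_map (R.U z) v).le

/-- The braiding `λ ⊗ z ^ k ↦ ζ ^ (k l) z ^ k ⊗ λ` for `λ` in `L` of degree `l`; equivalently,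
`λ ⊗ z ^ k ↦ z ^ k ⊗ U_{ζ ^ k} λ` for all `λ` in `L`. -/
def braiding : Seq R.L →L[ℂ] Seq R.L :=
  diagOp (fun k => (R.U (ζ ^ k) : R.L →L[ℂ] R.L)) 1 fun _ => R.norm_U_le _

/-- The inverse braiding `z ^ k ⊗ λ ↦ ζ ^ (- k l) λ ⊗ z ^ k` for `λ` in `L` of degree `l`. -/
def dualBraiding : Seq R.L →L[ℂ] Seq R.L :=
  diagOp (fun k => (R.U (ζ ^ (-k)) : R.L →L[ℂ] R.L)) 1 fun _ => R.norm_U_le _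

/-- The operator `b ⊗ 1` on `L ⊗ L²(𝕋)`. -/
def ampl (b : BraidedAo D) : Seq R.L →L[ℂ] Seq R.L :=
  diagOp (fun _ => R.hom b) ‖R.hom b‖ fun _ => le_rfl

/-- The embedding of `A_o(V, π, ω)` in the braided tensor product `C(𝕋) ⊠ A_o(V, π, ω)`. -/
def j₂ (b : BraidedAo D) : Seq R.L →L[ℂ] Seq R.L := R.braiding * R.ampl b * R.dualBraiding

/-- The unitary `j₁(z) = z ⊗ 1`. -/
def j₁z : unitary (Seq R.L →L[ℂ] Seq R.L) := Unitary.linearIsometryEquiv.symm shift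

/-- The underlying C*-algebra of the bosonisation: the braided tensor product
`C(𝕋) ⊠ A_o(V, π, ω)`, that is, the C*-algebra of operators on `L²(𝕋) ⊗ L` generated by
`j₁(C(𝕋))` and `j₂(A_o(V, π, ω))`. -/
def bosonisation : StarSubalgebra ℂ (Seq R.L →L[ℂ] Seq R.L) :=
  (StarAlgebra.adjoin ℂ (insert (R.j₁z : Seq R.L →L[ℂ] Seq R.L)
    (Set.range R.j₂))).topologicalClosure

/-- The C*-algebra `C` of the bosonisation. -/
abbrev C : Type := R.bosonisation

instance : CStarAlgebra R.C :=
  StarSubalgebra.cstarAlgebra R.bosonisation (h_closed := StarSubalgebra.isClosed_topologicalClosure _)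

/-- The unitary `z` in `C`. -/
def z : unitary R.C :=
  ⟨⟨R.j₁z, StarSubalgebra.le_topologicalClosure _ (StarAlgebra.subset_adjoin ℂ _
      (Set.mem_insert _ _))⟩,
    Unitary.mem_iff.2 ⟨Subtype.ext (Unitary.coe_star_mul_self R.j₁z),
      Subtype.ext (Unitary.coe_mul_star_self R.j₁z)⟩⟩

/-- The elements `u i j` of `C`. -/
def u (i j : Fin D.n) : R.C :=
  ⟨R.j₂ (BraidedAo.u D i j), StarSubalgebra.le_topologicalClosure _ (StarAlgebra.subset_adjoin ℂ _
      (Set.mem_insert_of_mem _ (Set.mem_range_self _)))⟩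

/-- The elements `t i j = z ^ (deg i) u i j` of `C`. -/
def t (i j : Fin D.n) : R.C := ((R.z ^ D.deg i : unitary R.C) : R.C) * R.u i j

/-- The defining property of the comultiplication of the bosonisation. It determines a
`*`-homomorphism because `z` and the `u i k` generate `C`. -/
def IsComul (Δ : R.C →⋆ₐ[ℂ] MinTensor R.C R.C) : Prop :=
  Δ (R.z : R.C) = MinTensor.tmul (R.z : R.C) (R.z : R.C) ∧
    ∀ i k, Δ (R.u i k) = ∑ l, MinTensor.tmul (R.u i l)
      (((R.z ^ (D.deg l - D.deg i) : unitary R.C) : R.C) * R.u l k)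

end EquivariantRep

end Bosonisation

/-- For `d = 0`, the matrix `F = Ωᵀ` is homogeneous of degree `0`. -/
theorem BraidedData.transpose_homogeneous {ζ : Circle} (D : BraidedData ζ) (hd : D.d = 0) :
    ∀ i j, D.Ω.transpose i j ≠ 0 → D.deg i + D.deg j = 0 := fun i j h => by
  rw [add_comm, D.homogeneous j i h, hd]

end BraidedOrth

end

/-! Write `d_i` for the degrees, `β` for the circle action on `A_o(V, π, ω)` and `K` for the crossed
product of `A_o(F)` by `α`. In the bosonisation, `j₂(b)` acts in degree `k` of `ℓ²(ℤ, L)` as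
`β_{ζ^k}(b)`, and `z` is the shift. Hence `z u_ij = ζ^(d_i - d_j) u_ij z`. The factor `z^(d_i)` in
`t_ij = z^(d_i) u_ij` absorbs the braiding: multiplying the rows of a matrix by unitaries keeps it
unitary. Moving all powers of `z` to the left turns the relation `Ω_{ik} t_{jk} = Ω_{kj} t_{ki}^*`
(summed over `k`) into the braided relation for `u`. Homogeneity with `d = 0` makes the powers of
`z` on both sides equal, and the powers of `ζ` picked up on the way are exactly those in the braided
relation (`zpow_mul_intertwiner_iff`). Being an equivalence, this serves twice. It gives `φ : A_o(F)
→ C`, hence `Φ : K → C` by covariance. It also gives `ψ : A_o(V, π, ω) → K`, `u_ij ↦ z^(-d_i) x_ij`,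
with `Φ ∘ ψ = j₂`.

Injectivity of `Φ` is the main point. The circle acts on `K` by `z ↦ w z` and `x_ij ↦ w^(d_i) x_ij`,
which fixes the range of `ψ`. Averaging this gauge action gives a faithful positive map that sends
`z^m ψ(b)` to a multiple of `ψ(b)` if `m = 0` and to `0` otherwise. The elements `z^m ψ(b)` span a
dense `*`-subalgebra. On this span the average of `a` is controlled by the `(0,0)` coefficient of
the operator `Φ(a)`, because the representation of `A_o(V, π, ω)` on `L` is isometric. So `Φ(a) = 0`
forces the average of `a* a` to vanish, and then `a = 0`. Surjectivity is then easy: an isometric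
`Φ` has closed range, and the range contains `z` and all `j₂(b)`.

`A_o(F)` embeds in `K` by the regular representation induced from GNS representations, so `φ` is
injective. The comultiplication of `C` is built on `K` from `(φ ⊗ φ) ∘ Δ` and `z ⊗ z`, and
transported along `Φ`. Compatibility with `φ` therefore holds by construction, and uniqueness
follows from surjectivity of `Φ`. -/

noncomputable section

namespace BraidedOrth

/-! ### Positive functionals and separating representations -/

section Positive

open scoped ComplexOrder ComplexStarModule

variable {A : Type*} [CStarAlgebra A] [PartialOrder A] [StarOrderedRing A]

/-- Continuous positive functionals separate a positive element from zero. -/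
theorem exists_positive_functional {b : A} (hb : 0 ≤ b) (hb0 : b ≠ 0) :
    ∃ f : A →L[ℝ] ℝ, (∀ x, 0 ≤ x → 0 ≤ f x) ∧ 0 < f b := by
  let K : ProperCone ℝ A :=
    { carrier := {x | 0 ≤ x}
      add_mem' := fun hx hy => add_nonneg hx hy
      zero_mem' := le_rfl
      smul_mem' := fun c x hx => by
        change 0 ≤ (c : ℝ) • x
        exact smul_nonneg c.2 hx
      isClosed' := CStarAlgebra.isClosed_nonneg }
  have hmem : ∀ x, x ∈ K ↔ 0 ≤ x := fun x => Iff.rfl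
  -- Hahn–Banach for the closed cone of positive elements: `-b` lies outside it, since otherwise `b
  -- ≤ 0 ≤ b`. The separating functional is nonnegative on the cone and negative at `-b`.
  obtain ⟨f, hf, hfb⟩ := K.hyperplane_separation_point (x₀ := -b) (by
    rw [hmem]
    intro h
    exact hb0 (le_antisymm (neg_nonneg.1 h) hb))
  refine ⟨f, fun x hx => hf x hx, ?_⟩
  rw [map_neg] at hfb
  linarith

/-- Positive linear functionals separate a positive element from zero. -/
theorem exists_positiveLinearMap {b : A} (hb : 0 ≤ b) (hb0 : b ≠ 0) :
    ∃ f : A →ₚ[ℂ] ℂ, f b ≠ 0 := by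
  obtain ⟨f, hf, hfb⟩ := exists_positive_functional hb hb0
  -- The complex-linear extension of the restriction of `f` to the self-adjoint part.
  let g : A →ₗ[ℂ] ℂ :=
    { toFun := fun a => (f (ℜ a : A) : ℂ) + Complex.I * f (ℑ a : A)
      map_add' := fun a c => by simp; ring
      map_smul' := fun c a => by
        rw [realPart_smul, imaginaryPart_smul]
        apply Complex.ext <;> simp }
  have hg : ∀ x, 0 ≤ x → g x = f x := fun x hx => by
    have h1 := (IsSelfAdjoint.of_nonneg hx).coe_realPart
    have h2 := (IsSelfAdjoint.of_nonneg hx).imaginaryPart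
    change (f (ℜ x : A) : ℂ) + Complex.I * f (ℑ x : A) = f x
    rw [h1, h2]; simp
  refine ⟨PositiveLinearMap.mk₀ g fun x hx => ?_, ?_⟩
  · rw [hg x hx]; exact_mod_cast hf x hx
  · change g b ≠ 0
    rw [hg b hb]; exact_mod_cast hfb.ne'

end Positive

/-- A nonzero element of a C*-algebra is nonzero in some unital representation. -/
theorem exists_rep_ne_zero {A : Type*} [CStarAlgebra A] {a : A} (ha : a ≠ 0) :
    ∃ ρ : Rep A, ρ.hom a ≠ 0 := by
  let _ := CStarAlgebra.spectralOrder A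
  have _ := CStarAlgebra.spectralOrderedRing A
  obtain ⟨f, hf⟩ := exists_positiveLinearMap (star_mul_self_nonneg a)
    ((CStarRing.star_mul_self_ne_zero_iff a).2 ha)
  refine ⟨⟨f.GNS, f.gnsStarAlgHom⟩, fun h => hf ?_⟩
  -- In the GNS representation the vector given by `1` satisfies `‖a · 1‖² = f(a* a)`, so an
  -- operator that vanishes there would force `f(a* a) = 0`.
  have h1 : f.gnsNonUnitalStarAlgHom a (f.toPreGNS 1 : f.GNS) = 0 := by
    have : f.gnsNonUnitalStarAlgHom a = 0 := h
    rw [this]; rfl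
  rw [PositiveLinearMap.gnsNonUnitalStarAlgHom_apply_coe, ← norm_eq_zero,
    UniformSpace.Completion.norm_coe] at h1
  have h2 := f.preGNS_norm_sq (f.leftMulMapPreGNS a (f.toPreGNS 1))
  rw [h1] at h2
  simpa using h2.symm

/-! ### Generation of universal C*-algebras -/

section ClosedSubalgebra

/-- A closed `*`-subalgebra of a universal C*-algebra that contains the generators is everything. -/
theorem UnivCStar.eq_top_of_gen_mem {X : Type*} {R : Set (FreeStar X)} (h : BoundedRel R)
    (S : StarSubalgebra ℂ (UnivCStar h)) (hS : IsClosed (S : Set (UnivCStar h)))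
    (hg : ∀ x, UnivCStar.gen h x ∈ S) (a : UnivCStar h) : a ∈ S := by
  refine CStarCompletion.induction _ a hS fun a => ?_
  change CStarCompletion.of (univSeminorm h) a ∈ S
  induction a using FreeStar.induction with
  | h₁ c =>
    rw [Algebra.algebraMap_eq_smul_one, map_smul, map_one]
    exact S.smul_mem (one_mem S) c
  | h₂ y =>
    rcases y with x | x
    · exact hg x
    · rw [FreeStar.letter_inr, map_star]
      exact star_mem (hg x)
  | h₃ a b ha hb => rw [map_mul]; exact mul_mem ha hb
  | h₄ a b ha hb => rw [map_add]; exact add_mem ha hb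

theorem continuous_starAlgHom {A B : Type*} [CStarAlgebra A] [CStarAlgebra B] (f : A →⋆ₐ[ℂ] B) :
    Continuous f :=
  AddMonoidHomClass.continuous_of_bound f 1 fun a => by
    rw [one_mul]; exact NonUnitalStarAlgHom.norm_apply_le f a

/-- A closed `*`-subalgebra of `A_o(F)` that contains the generators is everything. -/
theorem Ao.mem_of_x_mem {n : ℕ} {F : Matrix (Fin n) (Fin n) ℂ} (S : StarSubalgebra ℂ (Ao F))
    (hS : IsClosed (S : Set (Ao F))) (hg : ∀ i j, Ao.x F i j ∈ S) (a : Ao F) : a ∈ S :=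
  UnivCStar.eq_top_of_gen_mem _ S hS (fun p => hg p.1 p.2) a

end ClosedSubalgebra

/-! ### Universal property of the crossed product -/

namespace Crossed

variable {A : Type*} [CStarAlgebra A] {α : A ≃⋆ₐ[ℂ] A}

theorem star_z_mul_z : star (z α) * z α = 1 := by
  have h := UnivCStar.of_rel (boundedRel_crossed α) (CrossedRel.isometry (α := α))
  simp only [map_sub, map_mul, map_star, map_one, sub_eq_zero] at h
  exact h

theorem z_mul_star_z : z α * star (z α) = 1 := by
  have h := UnivCStar.of_rel (boundedRel_crossed α) (CrossedRel.coisometry (α := α))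
  simp only [map_sub, map_mul, map_star, map_one, sub_eq_zero] at h
  exact h

variable (α) in
/-- The canonical unitary, as an element of the unitary group. -/
def zu : unitary (Crossed α) := ⟨z α, Unitary.mem_iff.2 ⟨star_z_mul_z, z_mul_star_z⟩⟩

theorem coe_zu : (zu α : Crossed α) = z α := rfl

theorem covariance (a : A) : z α * incl α a * star (z α) = incl α (α a) := by
  have h := UnivCStar.of_rel (boundedRel_crossed α) (CrossedRel.covariance (α := α) a)
  simp only [map_sub, map_mul, map_star, sub_eq_zero] at h
  exact h

variable {B : Type*} [CStarAlgebra B]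

/-- The universal property of the crossed product. -/
def lift (f : A →⋆ₐ[ℂ] B) (v : unitary B)
    (hv : ∀ a, (v : B) * f a * star (v : B) = f (α a)) : Crossed α →⋆ₐ[ℂ] B :=
  UnivCStar.lift (boundedRel_crossed α) (fun y => y.elim (v : B) f) (by
    intro r hr
    cases hr with
    | add a b => simp [FreeStar.lift_gen]
    | smul c a => simp [FreeStar.lift_gen]
    | mul a b => simp [FreeStar.lift_gen]
    | one => simp [FreeStar.lift_gen]
    | star a => simp [FreeStar.lift_gen, map_star]
    | isometry => simp [FreeStar.lift_gen, map_star]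
    | coisometry => simp [FreeStar.lift_gen, map_star]
    | covariance a => simp [FreeStar.lift_gen, map_star, hv])

@[simp] theorem lift_incl (f : A →⋆ₐ[ℂ] B) (v : unitary B)
    (hv : ∀ a, (v : B) * f a * star (v : B) = f (α a)) (a : A) :
    lift f v hv (incl α a) = f a :=
  UnivCStar.lift_gen (boundedRel_crossed α) _ _ (some a)

@[simp] theorem lift_z (f : A →⋆ₐ[ℂ] B) (v : unitary B)
    (hv : ∀ a, (v : B) * f a * star (v : B) = f (α a)) : lift f v hv (z α) = v :=
  UnivCStar.lift_gen (boundedRel_crossed α) _ _ none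

theorem hom_ext {f g : Crossed α →⋆ₐ[ℂ] B} (h : ∀ a, f (incl α a) = g (incl α a))
    (hz : f (z α) = g (z α)) : f = g :=
  UnivCStar.hom_ext _ fun x => by
    rcases x with _ | a
    · exact hz
    · exact h a

theorem eq_top_of_mem (S : StarSubalgebra ℂ (Crossed α)) (hS : IsClosed (S : Set (Crossed α)))
    (hz : z α ∈ S) (hg : ∀ a, incl α a ∈ S) (a : Crossed α) : a ∈ S :=
  UnivCStar.eq_top_of_gen_mem _ S hS (fun x => by
    rcases x with _ | a
    · exact hz
    · exact hg a) a

end Crossed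

/-! ### Operators on `ℓ²(ℤ, L)` and the regular representation -/

section Regular

variable {L : Type} [NormedAddCommGroup L] [InnerProductSpace ℂ L] [CompleteSpace L]

variable (L) in
/-- The shift as an element of the unitary group. -/
def shiftUnitary : unitary (Seq L →L[ℂ] Seq L) := Unitary.linearIsometryEquiv.symm shift

theorem shiftUnitary_apply (f : Seq L) (k : ℤ) :
    (shiftUnitary L : Seq L →L[ℂ] Seq L) f k = f (k - 1) := rfl

theorem star_shiftUnitary_apply (f : Seq L) (k : ℤ) :
    star (shiftUnitary L : Seq L →L[ℂ] Seq L) f k = f (k + 1) := by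
  have h : star (shiftUnitary L : Seq L →L[ℂ] Seq L) f = (shift (L := L)).symm f := by
    have h1 : (shiftUnitary L : Seq L →L[ℂ] Seq L) ((shift (L := L)).symm f) = f :=
      (shift (L := L)).apply_symm_apply f
    have h2 : star (shiftUnitary L : Seq L →L[ℂ] Seq L) *
      (shiftUnitary L : Seq L →L[ℂ] Seq L) = 1 := Unitary.coe_star_mul_self _
    have h3 := congrArg (fun T : Seq L →L[ℂ] Seq L => T ((shift (L := L)).symm f)) h2
    change star (shiftUnitary L : Seq L →L[ℂ] Seq L)
      ((shiftUnitary L : Seq L →L[ℂ] Seq L) ((shift (L := L)).symm f)) = _ at h3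
    rw [h1] at h3
    exact h3
  rw [h]
  exact congrArg f (by ring : k - (-1) = k + 1)

theorem star_diagOp (T : ℤ → L →L[ℂ] L) (M : ℝ) (hT : ∀ k, ‖T k‖ ≤ M)
    (hT' : ∀ k, ‖star (T k)‖ ≤ M) :
    star (diagOp T M hT) = diagOp (fun k => star (T k)) M hT' := by
  symm
  rw [ContinuousLinearMap.star_eq_adjoint, ContinuousLinearMap.eq_adjoint_iff]
  intro f g
  rw [lp.inner_eq_tsum, lp.inner_eq_tsum]
  refine tsum_congr fun k => ?_
  rw [diagOp_apply, diagOp_apply, ContinuousLinearMap.star_eq_adjoint,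
    ContinuousLinearMap.adjoint_inner_left]

/-- The diagonal representation of a C*-algebra given by a sequence of representations. -/
def diagHom {A : Type*} [CStarAlgebra A] (ρ : ℤ → A →⋆ₐ[ℂ] (L →L[ℂ] L)) :
    A →⋆ₐ[ℂ] (Seq L →L[ℂ] Seq L) where
  toFun a := diagOp (fun k => ρ k a) ‖a‖ fun k => NonUnitalStarAlgHom.norm_apply_le (ρ k) a
  map_one' := by ext f k; simp
  map_mul' a b := by ext f k; simp
  map_zero' := by ext f k; simp
  map_add' a b := by ext f k; simp
  commutes' c := by ext f k; simp [Algebra.algebraMap_eq_smul_one]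
  map_star' a := by
    rw [star_diagOp _ _ _ fun k => by
      rw [norm_star]; exact NonUnitalStarAlgHom.norm_apply_le (ρ k) a]
    ext f k
    simp [map_star]

/-- The regular representation induced from a representation `ρ` of `A` is covariant, so it factors
through the crossed product. It contains `ρ` as its coefficient in degree `0`, and `ρ` can be chosen
nonzero at any given nonzero element. -/
theorem Crossed.incl_injective {A : Type} [CStarAlgebra A] (α : A ≃⋆ₐ[ℂ] A) :
    Function.Injective (Crossed.incl α) := by
  rw [injective_iff_map_eq_zero]
  intro a ha
  by_contra hne
  obtain ⟨ρ, hρ⟩ := exists_rep_ne_zero hne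
  -- The sign of the exponent is forced: conjugation by the shift replaces `k` by `k - 1`, and
  -- `α^(-(k-1)) = α^(-k) α`.
  let D := diagHom fun k : ℤ => ρ.hom.comp ((α ^ (-k) : A ≃⋆ₐ[ℂ] A) : A →⋆ₐ[ℂ] A)
  have hD : ∀ b f k, D b f k = ρ.hom ((α ^ (-k) : A ≃⋆ₐ[ℂ] A) b) (f k) := fun b f k => rfl
  have hv : ∀ b, (shiftUnitary ρ.H : Seq ρ.H →L[ℂ] Seq ρ.H) * D b *
      star (shiftUnitary ρ.H : Seq ρ.H →L[ℂ] Seq ρ.H) = D (α b) := fun b => by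
    ext f k
    rw [mul_apply_eq_comp, mul_apply_eq_comp, shiftUnitary_apply, hD, hD,
      star_shiftUnitary_apply, sub_add_cancel]
    have : (α ^ (-(k - 1)) : A ≃⋆ₐ[ℂ] A) = α ^ (-k) * α := by
      rw [← zpow_add_one]; congr 1; ring
    rw [this]; rfl
  have h : D a = 0 := by
    rw [← Crossed.lift_incl D (shiftUnitary ρ.H) hv, ha, map_zero]
  apply hρ
  ext v
  -- In degree `0` the diagonal entry is `ρ(a)` itself.
  have h1 := hD a (lp.single 2 0 v) 0
  rw [h, lp.single_apply_self] at h1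
  simpa using h1.symm

end Regular

/-! ### Moving powers of a unitary past matrix entries -/

section Conj

variable {B : Type*} [CStarAlgebra B]

/-- Each factor `v` that passes `y` contributes one `c`. For negative exponents, multiplying the
hypothesis by `v⁻¹` on both sides shows that `v⁻¹` contributes `c⁻¹`. -/
theorem zpow_mul_eq_smul {v : unitary B} {y : B} {c : Circle}
    (h : (v : B) * y = (c : ℂ) • (y * (v : B))) (m : ℤ) :
    ((v ^ m : unitary B) : B) * y = ((c ^ m : Circle) : ℂ) • (y * ((v ^ m : unitary B) : B)) := by
  have hinv : ((v⁻¹ : unitary B) : B) * y =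
      ((c⁻¹ : Circle) : ℂ) • (y * ((v⁻¹ : unitary B) : B)) := by
    have h1 : ((v⁻¹ : unitary B) : B) * ((v : B) * y) * ((v⁻¹ : unitary B) : B) =
        y * ((v⁻¹ : unitary B) : B) := by
      rw [← mul_assoc, ← Submonoid.coe_mul, inv_mul_cancel, Submonoid.coe_one, one_mul]
    rw [h, mul_smul_comm, smul_mul_assoc, mul_assoc, mul_assoc, ← Submonoid.coe_mul,
      mul_inv_cancel, Submonoid.coe_one, mul_one] at h1
    rw [← h1, smul_smul, ← Circle.coe_mul, inv_mul_cancel, Circle.coe_one, one_smul]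
  induction m using Int.induction_on with
  | zero => simp
  | succ k ih =>
    rw [zpow_add_one, zpow_add_one, Submonoid.coe_mul, mul_assoc, h, mul_smul_comm, ← mul_assoc,
      ih, smul_mul_assoc, smul_smul, ← Circle.coe_mul, mul_comm c, mul_assoc]
  | pred k ih =>
    rw [zpow_sub_one, zpow_sub_one, Submonoid.coe_mul, mul_assoc, hinv, mul_smul_comm, ← mul_assoc,
      ih, smul_mul_assoc, smul_smul, ← Circle.coe_mul, mul_comm c⁻¹, mul_assoc]

theorem star_coe_zpow (v : unitary B) (m : ℤ) :
    star ((v ^ m : unitary B) : B) = ((v ^ (-m) : unitary B) : B) := by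
  rw [zpow_neg, ← Unitary.star_eq_inv, Unitary.coe_star]

theorem coe_zpow_mul_coe_zpow (v : unitary B) (m k : ℤ) :
    ((v ^ m : unitary B) : B) * ((v ^ k : unitary B) : B) = ((v ^ (m + k) : unitary B) : B) := by
  rw [zpow_add, Submonoid.coe_mul]

/-- The adjoint of the commutation relation for the exponent `-m`; the two inversions of the scalar
cancel. -/
theorem star_mul_zpow_eq_smul {v : unitary B} {y : B} {c : Circle}
    (h : (v : B) * y = (c : ℂ) • (y * (v : B))) (m : ℤ) :
    star y * ((v ^ m : unitary B) : B) =
      ((c ^ m : Circle) : ℂ) • (((v ^ m : unitary B) : B) * star y) := by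
  have h1 := congrArg star (zpow_mul_eq_smul h (-m))
  rw [star_mul, star_smul, star_mul, star_coe_zpow, neg_neg, Complex.star_def,
    ← Circle.coe_inv_eq_conj, ← zpow_neg, neg_neg] at h1
  exact h1

theorem map_coe_zpow {B' : Type*} [CStarAlgebra B'] (f : B →⋆ₐ[ℂ] B') {v : unitary B}
    {w : unitary B'} (h : f v = w) (m : ℤ) :
    f ((v ^ m : unitary B) : B) = ((w ^ m : unitary B') : B') := by
  have h1 : Unitary.map { toMonoidHom := (f : B →* B'), map_star' := map_star f } v = w :=
    Subtype.ext h
  rw [← h1, ← map_zpow]; rfl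

variable {n : ℕ} {v : unitary B} {y : Fin n → Fin n → B} (d : Fin n → ℤ)

/-- Scaling row `k` by `v^(d k)` is left multiplication by a diagonal unitary matrix, so no
commutation between `v` and `y` is needed. It is used for `v = z` in `C`, for the canonical unitary
of the crossed product, and for scalar `v`. -/
theorem zpow_mul_isometry (h : ∀ i j, ∑ k, star (y k i) * y k j = if i = j then 1 else 0)
    (i j : Fin n) :
    ∑ k, star (((v ^ d k : unitary B) : B) * y k i) * (((v ^ d k : unitary B) : B) * y k j) =
      if i = j then 1 else 0 := by
  rw [← h]
  refine Finset.sum_congr rfl fun k _ => ?_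
  rw [star_mul, mul_assoc, ← mul_assoc (star (_ : B)) _ (y k j), star_coe_zpow,
    coe_zpow_mul_coe_zpow, neg_add_cancel, zpow_zero, Submonoid.coe_one, one_mul]

theorem zpow_mul_coisometry (h : ∀ i j, ∑ k, y i k * star (y j k) = if i = j then 1 else 0)
    (i j : Fin n) :
    ∑ k, (((v ^ d i : unitary B) : B) * y i k) * star (((v ^ d j : unitary B) : B) * y j k) =
      if i = j then 1 else 0 := by
  have h1 : ∀ k, (((v ^ d i : unitary B) : B) * y i k) *
      star (((v ^ d j : unitary B) : B) * y j k) =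
      ((v ^ d i : unitary B) : B) * (y i k * star (y j k)) * star ((v ^ d j : unitary B) : B) :=
    fun k => by rw [star_mul]; simp only [mul_assoc]
  rw [Finset.sum_congr rfl fun k _ => h1 k, ← Finset.sum_mul, ← Finset.mul_sum, h]
  split_ifs with hij
  · subst hij
    rw [mul_one, star_coe_zpow, coe_zpow_mul_coe_zpow, add_neg_cancel, zpow_zero,
      Submonoid.coe_one]
  · rw [mul_zero, zero_mul]

variable {ζ : Circle} {Ω : Matrix (Fin n) (Fin n) ℂ}

/-- The braided invariance relation for `y` is the intertwiner relation for `z ^ (d i) y i j`. -/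
theorem zpow_mul_intertwiner_iff (hΩ : ∀ i j, Ω i j ≠ 0 → d i + d j = 0)
    (hy : ∀ i j, (v : B) * y i j = ((ζ ^ (d i - d j) : Circle) : ℂ) • (y i j * (v : B)))
    (i j : Fin n) :
    ∑ k, Ω i k • (((v ^ d j : unitary B) : B) * y j k) =
        ∑ k, Ω k j • star (((v ^ d k : unitary B) : B) * y k i) ↔
      ((ζ ^ (d j * d i) : Circle) : ℂ) • ∑ k, Ω i k • y j k =
        ((ζ ^ (d j * (0 - d j)) : Circle) : ℂ) • ∑ k, Ω k j • star (y k i) := by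
  have h1 : ∑ k, Ω i k • (((v ^ d j : unitary B) : B) * y j k) =
      ((v ^ d j : unitary B) : B) * ∑ k, Ω i k • y j k := by
    simp only [Finset.mul_sum, mul_smul_comm]
  have h2 : ∑ k, Ω k j • star (((v ^ d k : unitary B) : B) * y k i) =
      ((v ^ d j : unitary B) : B) *
        (((ζ ^ (d j * (0 - d j) - d j * d i) : Circle) : ℂ) • ∑ k, Ω k j • star (y k i)) := by
    simp only [Finset.mul_sum, Finset.smul_sum, mul_smul_comm]
    refine Finset.sum_congr rfl fun k _ => ?_
    by_cases hk : Ω k j = 0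
    · rw [hk, zero_smul, zero_smul, smul_zero]
    -- Only these `k` contribute, and for them the adjoint of `v^(d k)` is `v^(d j)`, the same power
    -- for all `k`. Moving it to the left of the adjoint of `y k i` costs `ζ^((d k - d i) d j)`,
    -- which no longer depends on `k`.
    · have hd : d k = - d j := by have := hΩ k j hk; lia
      rw [star_mul, star_coe_zpow, hd, neg_neg, star_mul_zpow_eq_smul (hy k i), ← zpow_mul,
        smul_comm, hd]
      congr 4
      ring
  have h3 : Function.Injective fun b : B => ((v ^ d j : unitary B) : B) * b :=
    fun b c hbc => by
      have := congrArg (fun x => star ((v ^ d j : unitary B) : B) * x) hbc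
      simpa only [← mul_assoc, Unitary.coe_star_mul_self, one_mul] using this
  -- After cancelling the common left factor `v^(d j)`, the scalar `ζ^(-(d j * d i))` on the right
  -- is moved to the other side.
  rw [h1, h2, h3.eq_iff, zpow_sub, mul_comm (ζ ^ _), Circle.coe_mul, mul_smul, Circle.coe_inv,
    eq_inv_smul_iff₀ (Circle.coe_ne_zero _)]

end Conj

/-! ### The homomorphisms `j₂`, `φ`, `Φ` and `ψ` -/

section Maps

variable {ζ : Circle} {D : BraidedData ζ} (R : EquivariantRep D)

namespace EquivariantRep

/-- The embedding `j₂` as a `*`-homomorphism. -/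
def j₂Hom : BraidedAo D →⋆ₐ[ℂ] (Seq R.L →L[ℂ] Seq R.L) :=
  diagHom fun k => R.hom.comp (BraidedAo.action D (ζ ^ k))

theorem star_U (w : Circle) : star (R.U w : R.L →L[ℂ] R.L) = R.U w⁻¹ := by
  rw [map_inv, ← Unitary.star_eq_inv, Unitary.coe_star]

/-- The braidings conjugate by `U_{ζ^k}` in degree `k`, and equivariance turns this into the action
`β_{ζ^k}`. In this form `j₂` is a diagonal sum of representations, hence a `*`-homomorphism. -/
theorem j₂Hom_eq (b : BraidedAo D) : R.j₂Hom b = R.j₂ b := by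
  ext f k
  change R.hom (BraidedAo.action D (ζ ^ k) b) (f k) = _
  rw [R.equivariant, star_U, ← zpow_neg]
  rfl

theorem j₂Hom_apply (b : BraidedAo D) (f : Seq R.L) (k : ℤ) :
    R.j₂Hom b f k = R.hom (BraidedAo.action D (ζ ^ k) b) (f k) := rfl

theorem action_one : BraidedAo.action D 1 = StarAlgHom.id ℂ _ :=
  UnivCStar.hom_ext _ fun p => by
    have := BraidedAo.action_u D 1 p.1 p.2
    rw [one_zpow, Circle.coe_one, one_smul] at this
    exact this

theorem action_action (w w' : Circle) (b : BraidedAo D) :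
    BraidedAo.action D w (BraidedAo.action D w' b) = BraidedAo.action D (w * w') b := by
  have : (BraidedAo.action D w).comp (BraidedAo.action D w') = BraidedAo.action D (w * w') :=
    UnivCStar.hom_ext _ fun p => by
      change BraidedAo.action D w (BraidedAo.action D w' (BraidedAo.u D p.1 p.2)) =
        BraidedAo.action D (w * w') (BraidedAo.u D p.1 p.2)
      rw [BraidedAo.action_u, map_smul, BraidedAo.action_u, BraidedAo.action_u, smul_smul,
        ← Circle.coe_mul, ← mul_zpow, mul_comm w']
  rw [← this]; rfl

/-- The shift brings degree `k - 1` into degree `k`, so `β_{ζ^(k-1)} = β_{ζ^k} β_{ζ⁻¹}` acts where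
`β_{ζ^k}` did. -/
theorem j₁z_mul_j₂Hom (b : BraidedAo D) :
    (R.j₁z : Seq R.L →L[ℂ] Seq R.L) * R.j₂Hom b =
      R.j₂Hom (BraidedAo.action D ζ⁻¹ b) * (R.j₁z : Seq R.L →L[ℂ] Seq R.L) := by
  ext f k
  rw [mul_apply_eq_comp, mul_apply_eq_comp, j₂Hom_apply, action_action]
  change R.j₂Hom b f (k - 1) = R.hom _ (f (k - 1))
  rw [j₂Hom_apply, zpow_sub_one]

/-- The embedding of `A_o(V, π, ω)` in the C*-algebra of the bosonisation. -/
def j₂C : BraidedAo D →⋆ₐ[ℂ] R.C :=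
  R.j₂Hom.codRestrict R.bosonisation fun b => by
    rw [j₂Hom_eq]
    exact StarSubalgebra.le_topologicalClosure _ (StarAlgebra.subset_adjoin ℂ _
      (Set.mem_insert_of_mem _ (Set.mem_range_self _)))

theorem j₂C_u (i j : Fin D.n) : R.j₂C (BraidedAo.u D i j) = R.u i j :=
  Subtype.ext (R.j₂Hom_eq _)

theorem z_mul_j₂C (b : BraidedAo D) :
    (R.z : R.C) * R.j₂C b = R.j₂C (BraidedAo.action D ζ⁻¹ b) * (R.z : R.C) :=
  Subtype.ext (R.j₁z_mul_j₂Hom b)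

theorem z_mul_u (i j : Fin D.n) : (R.z : R.C) * R.u i j =
    ((ζ ^ (D.deg i - D.deg j) : Circle) : ℂ) • (R.u i j * (R.z : R.C)) := by
  rw [← j₂C_u, z_mul_j₂C, BraidedAo.action_u, map_smul, smul_mul_assoc, inv_zpow, ← zpow_neg,
    neg_sub]

/-- As `z` commutes with its powers, `t i j` inherits the commutation relation of `u i j`. The
scalar is the one by which `α` acts on `x i j`, so this is covariance of the pair `(φ, z)`. -/
theorem z_mul_t (i j : Fin D.n) : (R.z : R.C) * R.t i j =
    ((ζ ^ (D.deg i - D.deg j) : Circle) : ℂ) • (R.t i j * (R.z : R.C)) := by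
  have h : (R.z : R.C) * ((R.z ^ D.deg i : unitary R.C) : R.C) =
      ((R.z ^ D.deg i : unitary R.C) : R.C) * (R.z : R.C) := by
    rw [← Submonoid.coe_mul, ← Submonoid.coe_mul, (Commute.self_zpow R.z _).eq]
  rw [t, ← mul_assoc, h, mul_assoc, z_mul_u, mul_smul_comm, mul_assoc]

theorem u_isometry (i j : Fin D.n) :
    ∑ k, star (R.u k i) * R.u k j = if i = j then 1 else 0 := by
  have h := congrArg R.j₂C (BraidedAo.isometry D i j)
  rw [apply_ite R.j₂C, map_one, map_zero] at h
  simpa only [map_sum, map_mul, map_star, j₂C_u] using h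

theorem u_coisometry (i j : Fin D.n) :
    ∑ k, R.u i k * star (R.u j k) = if i = j then 1 else 0 := by
  have h := congrArg R.j₂C (BraidedAo.coisometry D i j)
  rw [apply_ite R.j₂C, map_one, map_zero] at h
  simpa only [map_sum, map_mul, map_star, j₂C_u] using h

theorem u_invariant (i j : Fin D.n) :
    ((ζ ^ (D.deg j * D.deg i) : Circle) : ℂ) • ∑ k, D.Ω i k • R.u j k =
      ((ζ ^ (D.deg j * (D.d - D.deg j)) : Circle) : ℂ) • ∑ k, D.Ω k j • star (R.u k i) := by
  have h := congrArg R.j₂C (BraidedAo.invariant D i j)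
  simpa only [map_sum, map_smul, map_star, j₂C_u] using h

variable (hd : D.d = 0)

/-- The `*`-homomorphism `φ : A_o(F) → C` with `φ (x i j) = t i j`. -/
def phi : Ao D.Ω.transpose →⋆ₐ[ℂ] R.C :=
  Ao.lift R.t (zpow_mul_isometry D.deg R.u_isometry) (zpow_mul_coisometry D.deg R.u_coisometry)
    -- The transpose in `F = Ωᵀ` makes the relation of `A_o(F)` at `(i, j)` the one for `Ω` at `(j,
    -- i)`.
    fun i j => (zpow_mul_intertwiner_iff D.deg
      (fun i j h => (D.homogeneous i j h).trans hd) R.z_mul_u j i).2 (by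
        rw [u_invariant, hd])

theorem phi_x (i j : Fin D.n) : R.phi hd (Ao.x D.Ω.transpose i j) = R.t i j := Ao.lift_x _ _ _ _ i j

end EquivariantRep

/-- Covariance only has to be checked on the generators of `A_o(F)`. -/
theorem Ao.covariance_of_x {n : ℕ} {F : Matrix (Fin n) (Fin n) ℂ} {B : Type*} [CStarAlgebra B]
    {ζ : Circle} {d : Fin n → ℤ} {hF : ∀ i j, F i j ≠ 0 → d i + d j = 0}
    (f : Ao F →⋆ₐ[ℂ] B) (v : unitary B)
    (h : ∀ i j, (v : B) * f (Ao.x F i j) =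
      ((ζ ^ (d i - d j) : Circle) : ℂ) • (f (Ao.x F i j) * (v : B))) (a : Ao F) :
    (v : B) * f a * star (v : B) = f (Ao.twist ζ d hF a) := by
  -- Conjugation by `v` is a `*`-automorphism, so both sides are `*`-homomorphisms on `A_o(F)` and
  -- agree once they agree on generators.
  have key : ((Unitary.conjStarAlgAut ℂ B v : B ≃⋆ₐ[ℂ] B) : B →⋆ₐ[ℂ] B).comp f =
      f.comp (Ao.twist ζ d hF : Ao F →⋆ₐ[ℂ] Ao F) := Ao.hom_ext fun i j => by
    change (v : B) * f (Ao.x F i j) * star (v : B) = f (Ao.twist ζ d hF (Ao.x F i j))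
    rw [Ao.twist_x, map_smul, h, smul_mul_assoc, mul_assoc,
      Unitary.mul_star_self_of_mem v.2, mul_one]
  exact DFunLike.congr_fun key a

namespace EquivariantRep

variable (hd : D.d = 0)

/-- The `*`-homomorphism from the crossed product to the bosonisation. -/
def Phi : Crossed (Ao.twist ζ D.deg (D.transpose_homogeneous hd)) →⋆ₐ[ℂ] R.C :=
  Crossed.lift (R.phi hd) R.z (Ao.covariance_of_x _ _ fun i j => by rw [phi_x, z_mul_t])

theorem Phi_incl (a : Ao D.Ω.transpose) : R.Phi hd (Crossed.incl _ a) = R.phi hd a :=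
  Crossed.lift_incl _ _ _ a

theorem Phi_z : R.Phi hd (Crossed.z _) = (R.z : R.C) := Crossed.lift_z _ _ _

end EquivariantRep

namespace BraidedData

variable (D) (hd : D.d = 0)

/-- The crossed product of `A_o(F)` by the automorphism `α`. -/
abbrev K : Type := Crossed (Ao.twist ζ D.deg (D.transpose_homogeneous hd))

/-- The generators `x i j` in the crossed product. -/
def xK (i j : Fin D.n) : D.K hd := Crossed.incl _ (Ao.x D.Ω.transpose i j)

/-- The canonical unitary of the crossed product. -/
def zK : unitary (D.K hd) := Crossed.zu _

/-- The elements `z ^ (- deg i) x i j` of the crossed product. -/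
def uK (i j : Fin D.n) : D.K hd :=
  ((D.zK hd ^ (-D.deg i) : unitary (D.K hd)) : D.K hd) * D.xK hd i j

theorem zK_mul_xK (i j : Fin D.n) : (D.zK hd : D.K hd) * D.xK hd i j =
    ((ζ ^ (D.deg i - D.deg j) : Circle) : ℂ) • (D.xK hd i j * (D.zK hd : D.K hd)) := by
  have h := Crossed.covariance (α := Ao.twist ζ D.deg (D.transpose_homogeneous hd))
    (Ao.x D.Ω.transpose i j)
  rw [Ao.twist_x, map_smul] at h
  rw [xK, zK, Crossed.coe_zu, ← smul_mul_assoc, ← h, mul_assoc, Crossed.star_z_mul_z, mul_one]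

theorem zK_mul_uK (i j : Fin D.n) : (D.zK hd : D.K hd) * D.uK hd i j =
    ((ζ ^ (D.deg i - D.deg j) : Circle) : ℂ) • (D.uK hd i j * (D.zK hd : D.K hd)) := by
  have h : (D.zK hd : D.K hd) * ((D.zK hd ^ (-D.deg i) : unitary (D.K hd)) : D.K hd) =
      ((D.zK hd ^ (-D.deg i) : unitary (D.K hd)) : D.K hd) * (D.zK hd : D.K hd) := by
    rw [← Submonoid.coe_mul, ← Submonoid.coe_mul, (Commute.self_zpow (D.zK hd) _).eq]
  rw [uK, ← mul_assoc, h, mul_assoc, zK_mul_xK, mul_smul_comm, mul_assoc]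

theorem xK_eq (i j : Fin D.n) :
    D.xK hd i j = ((D.zK hd ^ D.deg i : unitary (D.K hd)) : D.K hd) * D.uK hd i j := by
  rw [uK, ← mul_assoc, coe_zpow_mul_coe_zpow, add_neg_cancel, zpow_zero, Submonoid.coe_one, one_mul]

theorem xK_isometry (i j : Fin D.n) :
    ∑ k, star (D.xK hd k i) * D.xK hd k j = if i = j then 1 else 0 := by
  have h := congrArg (Crossed.incl (Ao.twist ζ D.deg (D.transpose_homogeneous hd)))
    (Ao.isometry D.Ω.transpose i j)
  rw [apply_ite (Crossed.incl _), map_one, map_zero] at h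
  simp only [map_sum, map_mul, map_star] at h
  exact h

theorem xK_coisometry (i j : Fin D.n) :
    ∑ k, D.xK hd i k * star (D.xK hd j k) = if i = j then 1 else 0 := by
  have h := congrArg (Crossed.incl (Ao.twist ζ D.deg (D.transpose_homogeneous hd)))
    (Ao.coisometry D.Ω.transpose i j)
  rw [apply_ite (Crossed.incl _), map_one, map_zero] at h
  simp only [map_sum, map_mul, map_star] at h
  exact h

theorem xK_intertwiner (i j : Fin D.n) :
    ∑ k, D.Ω i k • D.xK hd j k = ∑ k, D.Ω k j • star (D.xK hd k i) := by
  have h := congrArg (Crossed.incl (Ao.twist ζ D.deg (D.transpose_homogeneous hd)))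
    (Ao.intertwiner D.Ω.transpose j i)
  simp only [map_sum, map_smul, map_star] at h
  exact h

/-- The `*`-homomorphism from `A_o(V, π, ω)` to the crossed product. -/
def psi : BraidedAo D →⋆ₐ[ℂ] D.K hd :=
  UnivCStar.lift (boundedRel_braidedAo D) (fun p => D.uK hd p.1 p.2) (by
    intro r hr
    cases hr with
    | unitary _ hr =>
      cases hr with
      | isometry i j =>
        exact (lift_isometry _ i j).2 (zpow_mul_isometry (fun k => -D.deg k) (D.xK_isometry hd) i j)
      | coisometry i j =>
        exact (lift_coisometry _ i j).2
          (zpow_mul_coisometry (fun k => -D.deg k) (D.xK_coisometry hd) i j)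
    | invariant i j =>
      simp only [map_sub, map_sum, map_smul, map_star, FreeStar.lift_gen, sub_eq_zero]
      rw [hd]
      -- The same equivalence as for `φ`, read backwards: `x i j` is `z^(deg i)` times `uK i j`, and
      -- `x` satisfies the unbraided relation.
      refine (zpow_mul_intertwiner_iff D.deg (fun i j h => (D.homogeneous i j h).trans hd)
        (D.zK_mul_uK hd) i j).1 ?_
      simp only [← xK_eq]
      exact D.xK_intertwiner hd i j)

theorem psi_u (i j : Fin D.n) : D.psi hd (BraidedAo.u D i j) = D.uK hd i j :=
  UnivCStar.lift_gen _ _ _ _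

end BraidedData

namespace BraidedAo

theorem hom_ext {B : Type*} [CStarAlgebra B] {f g : BraidedAo D →⋆ₐ[ℂ] B}
    (h : ∀ i j, f (u D i j) = g (u D i j)) : f = g :=
  UnivCStar.hom_ext _ fun p => h p.1 p.2

end BraidedAo

namespace EquivariantRep

variable (hd : D.d = 0)

theorem Phi_zK : R.Phi hd (D.zK hd : D.K hd) = (R.z : R.C) := R.Phi_z hd

/-- On generators, `z^(-deg i)` cancels the factor `z^(deg i)` in `t i j`. This puts the range of
`j₂` inside the range of `Φ` and computes `Φ` on all `z^m ψ(b)`. -/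
theorem Phi_psi (b : BraidedAo D) : R.Phi hd (D.psi hd b) = R.j₂C b := by
  have : (R.Phi hd).comp (D.psi hd) = R.j₂C := BraidedAo.hom_ext fun i j => by
    rw [StarAlgHom.comp_apply, D.psi_u, BraidedData.uK, map_mul,
      map_coe_zpow (R.Phi hd) (R.Phi_zK hd), BraidedData.xK, Phi_incl, phi_x, t, ← mul_assoc,
      coe_zpow_mul_coe_zpow, neg_add_cancel, zpow_zero, Submonoid.coe_one, one_mul, j₂C_u]
  rw [← this]; rfl

end EquivariantRep

end Maps

/-! ### Scalar unitaries -/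

section Scalar

variable (B : Type*) [CStarAlgebra B]

/-- The scalar unitaries of a unital C*-algebra. -/
def scalarUnitary : Circle →* unitary B where
  toFun w := ⟨algebraMap ℂ B w, by
    have h1 : star (algebraMap ℂ B w) = algebraMap ℂ B ((w⁻¹ : Circle) : ℂ) := by
      rw [← algebraMap_star_comm, Circle.coe_inv_eq_conj]; rfl
    rw [Unitary.mem_iff, h1, ← map_mul, ← map_mul, ← Circle.coe_mul, ← Circle.coe_mul,
      inv_mul_cancel, mul_inv_cancel, Circle.coe_one, map_one]
    exact ⟨rfl, rfl⟩⟩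
  map_one' := Subtype.ext (by simp)
  map_mul' w w' := Subtype.ext (by simp)

variable {B}

theorem coe_scalarUnitary (w : Circle) : (scalarUnitary B w : B) = algebraMap ℂ B w := rfl

theorem coe_scalarUnitary_zpow (w : Circle) (m : ℤ) :
    ((scalarUnitary B w ^ m : unitary B) : B) = algebraMap ℂ B ((w ^ m : Circle) : ℂ) := by
  rw [← map_zpow]; rfl

theorem scalarUnitary_commute (w : Circle) (v : unitary B) : Commute (scalarUnitary B w) v :=
  Subtype.ext (Algebra.commutes (w : ℂ) (v : B))

end Scalar

/-! ### Gauge action and conditional expectation on the crossed product -/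

namespace BraidedData

variable {ζ : Circle} (D : BraidedData ζ) (hd : D.d = 0)

/-- The `*`-homomorphism `x i j ↦ w ^ (deg i) • x i j` from `A_o(F)` to the crossed product. -/
def gaugeAo (w : Circle) : Ao D.Ω.transpose →⋆ₐ[ℂ] D.K hd :=
  Ao.lift (fun i j => ((scalarUnitary (D.K hd) w ^ D.deg i : unitary (D.K hd)) : D.K hd) *
      D.xK hd i j)
    (zpow_mul_isometry D.deg (D.xK_isometry hd)) (zpow_mul_coisometry D.deg (D.xK_coisometry hd))
    -- A scalar unitary commutes with everything, so the equivalence applies with trivial braiding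
    -- `ζ = 1`, and both conditions are then unbraided.
    fun i j => (zpow_mul_intertwiner_iff (ζ := 1) D.deg
      (fun i j h => (D.homogeneous i j h).trans hd)
      (fun i j => by
        rw [one_zpow, Circle.coe_one, one_smul, coe_scalarUnitary, Algebra.commutes]) j i).2 (by
        rw [one_zpow, one_zpow, D.xK_intertwiner hd])

theorem gaugeAo_x (w : Circle) (i j : Fin D.n) :
    D.gaugeAo hd w (Ao.x D.Ω.transpose i j) =
      ((w ^ D.deg i : Circle) : ℂ) • D.xK hd i j :=
  (Ao.lift_x _ _ _ _ i j).trans (by rw [coe_scalarUnitary_zpow, ← Algebra.smul_def])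

/-- The action of the circle on the crossed product that fixes the image of `A_o(V, π, ω)` and
maps `z` to `w z`. -/
def gauge (w : Circle) : D.K hd →⋆ₐ[ℂ] D.K hd :=
  Crossed.lift (D.gaugeAo hd w) (scalarUnitary (D.K hd) w * D.zK hd)
    (Ao.covariance_of_x _ _ fun i j => by
      rw [gaugeAo_x, Submonoid.coe_mul, coe_scalarUnitary, ← Algebra.smul_def, smul_mul_smul_comm,
        smul_mul_smul_comm, zK_mul_xK, smul_comm, mul_comm])

theorem gauge_zK_zpow (w : Circle) (m : ℤ) :
    D.gauge hd w ((D.zK hd ^ m : unitary (D.K hd)) : D.K hd) =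
      ((w ^ m : Circle) : ℂ) • ((D.zK hd ^ m : unitary (D.K hd)) : D.K hd) := by
  rw [map_coe_zpow (v := D.zK hd) (w := scalarUnitary (D.K hd) w * D.zK hd) (D.gauge hd w)
    (Crossed.lift_z _ _ _), (scalarUnitary_commute w _).mul_zpow, Submonoid.coe_mul,
    coe_scalarUnitary_zpow, ← Algebra.smul_def]

theorem gauge_xK (w : Circle) (i j : Fin D.n) :
    D.gauge hd w (D.xK hd i j) = ((w ^ D.deg i : Circle) : ℂ) • D.xK hd i j := by
  rw [← gaugeAo_x]; exact Crossed.lift_incl _ _ _ _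

/-- On generators, the factor `w^(-deg i)` from `z^(-deg i)` cancels the factor `w^(deg i)` from `x
i j`. -/
theorem gauge_psi (w : Circle) (b : BraidedAo D) : D.gauge hd w (D.psi hd b) = D.psi hd b := by
  have h : (D.gauge hd w).comp (D.psi hd) = D.psi hd := BraidedAo.hom_ext fun i j => by
    rw [StarAlgHom.comp_apply, psi_u, uK, map_mul, gauge_zK_zpow, gauge_xK, smul_mul_smul_comm,
      ← Circle.coe_mul, ← zpow_add, neg_add_cancel, zpow_zero, Circle.coe_one, one_smul]
  exact DFunLike.congr_fun h b

/-- Conjugation by `z^m` undoes `β_{ζ^m}` on the range of `ψ`, as one sees on generators. This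
allows all powers of `z` to be collected on the left. -/
theorem psi_mul_zK_zpow (b : BraidedAo D) (m : ℤ) :
    D.psi hd b * ((D.zK hd ^ m : unitary (D.K hd)) : D.K hd) =
      ((D.zK hd ^ m : unitary (D.K hd)) : D.K hd) * D.psi hd (BraidedAo.action D (ζ ^ m) b) := by
  have h : D.psi hd = ((Unitary.conjStarAlgAut ℂ (D.K hd) (D.zK hd ^ m) : D.K hd ≃⋆ₐ[ℂ] D.K hd) :
      D.K hd →⋆ₐ[ℂ] D.K hd).comp ((D.psi hd).comp (BraidedAo.action D (ζ ^ m))) :=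
    BraidedAo.hom_ext fun i j => by
      change _ = ((D.zK hd ^ m : unitary (D.K hd)) : D.K hd) *
        D.psi hd (BraidedAo.action D (ζ ^ m) (BraidedAo.u D i j)) *
          star ((D.zK hd ^ m : unitary (D.K hd)) : D.K hd)
      rw [BraidedAo.action_u, map_smul, psi_u, mul_smul_comm,
        zpow_mul_eq_smul (D.zK_mul_uK hd i j), smul_smul, ← Circle.coe_mul, ← zpow_mul, ← zpow_mul,
        ← zpow_add, smul_mul_assoc, mul_assoc, Unitary.mul_star_self_of_mem (Subtype.prop _),
        mul_one, show m * (D.deg j - D.deg i) + (D.deg i - D.deg j) * m = 0 by ring, zpow_zero,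
        Circle.coe_one, one_smul]
  have h1 := DFunLike.congr_fun h b
  change _ = ((D.zK hd ^ m : unitary (D.K hd)) : D.K hd) *
    D.psi hd (BraidedAo.action D (ζ ^ m) b) *
      star ((D.zK hd ^ m : unitary (D.K hd)) : D.K hd) at h1
  rw [h1, mul_assoc, Unitary.star_mul_self_of_mem (Subtype.prop _), mul_one]

/-- The linear span of the elements `z ^ m ψ(b)`. -/
def polySpan : Submodule ℂ (D.K hd) :=
  Submodule.span ℂ (Set.range fun p : ℤ × BraidedAo D =>
    ((D.zK hd ^ p.1 : unitary (D.K hd)) : D.K hd) * D.psi hd p.2)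

theorem mem_polySpan (m : ℤ) (b : BraidedAo D) :
    ((D.zK hd ^ m : unitary (D.K hd)) : D.K hd) * D.psi hd b ∈ D.polySpan hd :=
  Submodule.subset_span ⟨(m, b), rfl⟩

/-- The elements `z ^ m ψ(b)` span a `*`-subalgebra. -/
def polyAlgebra : StarSubalgebra ℂ (D.K hd) where
  carrier := D.polySpan hd
  add_mem' := add_mem
  mul_mem' {x y} hx hy := by
    have h := Submodule.mul_mem_mul hx hy
    rw [polySpan, Submodule.span_mul_span] at h
    refine Submodule.span_le.2 ?_ h
    rintro _ ⟨_, ⟨p, rfl⟩, _, ⟨q, rfl⟩, rfl⟩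
    change _ * _ * (_ * _) ∈ D.polySpan hd
    rw [mul_assoc, ← mul_assoc (D.psi hd _), psi_mul_zK_zpow, mul_assoc, ← map_mul, ← mul_assoc,
      coe_zpow_mul_coe_zpow]
    exact D.mem_polySpan hd _ _
  algebraMap_mem' c := by
    have := D.mem_polySpan hd 0 (algebraMap ℂ _ c)
    rw [zpow_zero, Submonoid.coe_one, one_mul, AlgHomClass.commutes] at this
    exact this
  star_mem' {x} hx := by
    change x ∈ D.polySpan hd at hx
    change star x ∈ D.polySpan hd
    induction hx using Submodule.span_induction with
    | mem x hx =>
      obtain ⟨p, rfl⟩ := hx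
      change star (_ * _) ∈ _
      rw [star_mul, star_coe_zpow, ← map_star, psi_mul_zK_zpow]
      exact D.mem_polySpan hd _ _
    | zero => rw [star_zero]; exact zero_mem _
    | add x y _ _ hx hy => rw [star_add]; exact add_mem hx hy
    | smul c x _ hx => rw [star_smul]; exact Submodule.smul_mem _ _ hx

/-- A closed `*`-subalgebra that contains `z` and the `x i j` is everything. -/
theorem mem_of_gen_mem (S : StarSubalgebra ℂ (D.K hd)) (hS : IsClosed (S : Set (D.K hd)))
    (hz : (D.zK hd : D.K hd) ∈ S) (hx : ∀ i j, D.xK hd i j ∈ S) (a : D.K hd) : a ∈ S :=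
  Crossed.eq_top_of_mem S hS hz (fun a => by
    have hcl : IsClosed (Crossed.incl (Ao.twist ζ D.deg (D.transpose_homogeneous hd)) ⁻¹'
        (S : Set (D.K hd))) := hS.preimage (continuous_starAlgHom _)
    exact Ao.mem_of_x_mem (S.comap (Crossed.incl _)) hcl hx a) a

/-- The closure is a closed `*`-subalgebra, and it contains the generators `z = z ψ(1)` and `x i j =
z^(deg i) ψ(u i j)`. -/
theorem dense_polySpan (a : D.K hd) : a ∈ closure (D.polySpan hd : Set (D.K hd)) := by
  have hsub : ∀ (m : ℤ) b, ((D.zK hd ^ m : unitary (D.K hd)) : D.K hd) * D.psi hd b ∈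
      (D.polyAlgebra hd).topologicalClosure := fun m b =>
    (D.polyAlgebra hd).le_topologicalClosure (D.mem_polySpan hd m b)
  refine D.mem_of_gen_mem hd (D.polyAlgebra hd).topologicalClosure
    (D.polyAlgebra hd).isClosed_topologicalClosure ?_ (fun i j => ?_) a
  · have := hsub 1 1
    rwa [map_one, mul_one, zpow_one] at this
  · rw [xK_eq, ← psi_u]
    exact hsub _ _

/-- The elements with continuous orbit map form a `*`-subalgebra containing the generators, whose
orbit maps are scalar multiples. It is closed because the maps `gauge w` are all contractive, so
that orbit maps of nearby elements are uniformly close. -/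
theorem continuous_gauge (a : D.K hd) : Continuous fun w => D.gauge hd w a := by
  let S : StarSubalgebra ℂ (D.K hd) :=
    { carrier := {a | Continuous fun w => D.gauge hd w a}
      add_mem' := fun {a b} ha hb => by
        change Continuous fun w => D.gauge hd w (a + b)
        simp only [map_add]
        exact Continuous.add ha hb
      mul_mem' := fun {a b} ha hb => by
        change Continuous fun w => D.gauge hd w (a * b)
        simp only [map_mul]
        exact Continuous.mul ha hb
      algebraMap_mem' := fun c => by
        change Continuous fun w => D.gauge hd w (algebraMap ℂ (D.K hd) c)
        simp only [AlgHomClass.commutes]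
        exact continuous_const
      star_mem' := fun {a} ha => by
        change Continuous fun w => D.gauge hd w (star a)
        simp only [map_star]
        exact Continuous.star ha }
  have hw : ∀ m : ℤ, Continuous fun w : Circle => ((w ^ m : Circle) : ℂ) := fun m =>
    continuous_subtype_val.comp (continuous_zpow m)
  refine D.mem_of_gen_mem hd S ?_ ?_ (fun i j => ?_) a
  · refine isClosed_of_closure_subset fun a ha => ?_
    change Continuous fun w => D.gauge hd w a
    refine continuous_of_uniform_approx_of_continuous fun u hu => ?_
    obtain ⟨ε, hε, hu⟩ := Metric.mem_uniformity_dist.1 hu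
    obtain ⟨b, hb, hab⟩ := Metric.mem_closure_iff.1 ha ε hε
    refine ⟨_, hb, fun w => hu ?_⟩
    rw [dist_eq_norm, ← map_sub]
    rw [dist_eq_norm] at hab
    exact (NonUnitalStarAlgHom.norm_apply_le (D.gauge hd w) _).trans_lt hab
  · change Continuous fun w => D.gauge hd w (D.zK hd : D.K hd)
    have h : ∀ w, D.gauge hd w (D.zK hd : D.K hd) =
        ((w ^ (1 : ℤ) : Circle) : ℂ) • (D.zK hd : D.K hd) := fun w => by
      have := D.gauge_zK_zpow hd w 1
      rwa [zpow_one (D.zK hd)] at this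
    simp only [h]
    exact (hw 1).smul continuous_const
  · change Continuous fun w => D.gauge hd w (D.xK hd i j)
    simp only [gauge_xK]
    exact (hw _).smul continuous_const

/-- The integral of the gauge action, a multiple of the conditional expectation onto the image
of `A_o(V, π, ω)`. -/
def average (a : D.K hd) : D.K hd := ∫ θ in (0 : ℝ)..2 * Real.pi, D.gauge hd (Circle.exp θ) a

theorem continuous_gauge_exp (a : D.K hd) : Continuous fun θ => D.gauge hd (Circle.exp θ) a :=
  (D.continuous_gauge hd a).comp Circle.exp.continuous

theorem average_add (a b : D.K hd) : D.average hd (a + b) = D.average hd a + D.average hd b := by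
  simp only [average, map_add]
  exact intervalIntegral.integral_add ((D.continuous_gauge_exp hd a).intervalIntegrable _ _)
    ((D.continuous_gauge_exp hd b).intervalIntegrable _ _)

theorem average_smul (c : ℂ) (a : D.K hd) : D.average hd (c • a) = c • D.average hd a := by
  simp only [average, map_smul]
  exact intervalIntegral.integral_smul c _

theorem norm_average_le (a : D.K hd) : ‖D.average hd a‖ ≤ 2 * Real.pi * ‖a‖ := by
  have h := intervalIntegral.norm_integral_le_of_norm_le_const (a := 0) (b := 2 * Real.pi)
    (f := fun θ => D.gauge hd (Circle.exp θ) a) (C := ‖a‖)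
    fun θ _ => NonUnitalStarAlgHom.norm_apply_le _ a
  rw [sub_zero, abs_of_pos Real.two_pi_pos, mul_comm ‖a‖] at h
  exact h

theorem continuous_average : Continuous (D.average hd) :=
  AddMonoidHomClass.continuous_of_bound
    (AddMonoidHom.mk' (D.average hd) (D.average_add hd)) (2 * Real.pi) (D.norm_average_le hd)

theorem integral_exp_zpow (m : ℤ) :
    ∫ θ in (0 : ℝ)..2 * Real.pi, ((Circle.exp θ ^ m : Circle) : ℂ) =
      if m = 0 then (2 * Real.pi : ℂ) else 0 := by
  split_ifs with hm
  · subst hm; simp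
  · have h : ∀ θ : ℝ, ((Circle.exp θ ^ m : Circle) : ℂ) = Complex.exp (m * Complex.I * θ) :=
      fun θ => by
      rw [Circle.coe_zpow, Circle.coe_exp, ← Complex.exp_int_mul]; congr 1; ring
    have hc : (m * Complex.I : ℂ) ≠ 0 :=
      mul_ne_zero (Int.cast_ne_zero.2 hm) Complex.I_ne_zero
    simp only [h]
    rw [integral_exp_mul_complex hc]
    have h2 : (m * Complex.I * ((2 * Real.pi : ℝ) : ℂ) : ℂ) = m * (2 * Real.pi * Complex.I) := by
      push_cast; ring
    rw [h2, Complex.exp_int_mul_two_pi_mul_I]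
    simp

/-- The gauge action multiplies `z^m ψ(b)` by the character `w^m`, whose integral vanishes unless `m
= 0`. The factor `2π` appears because the integral is not normalised. -/
theorem average_zpow_mul_psi (m : ℤ) (b : BraidedAo D) :
    D.average hd (((D.zK hd ^ m : unitary (D.K hd)) : D.K hd) * D.psi hd b) =
      if m = 0 then (2 * Real.pi : ℂ) • D.psi hd b else 0 := by
  simp only [average, map_mul, gauge_zK_zpow, gauge_psi, smul_mul_assoc]
  rw [intervalIntegral.integral_smul_const, integral_exp_zpow]
  split_ifs with hm
  · rw [hm, zpow_zero, Submonoid.coe_one, one_mul]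
  · rw [zero_smul]

/-- The conditional expectation is faithful. -/
theorem eq_zero_of_average_eq_zero {a : D.K hd} (ha : D.average hd (star a * a) = 0) : a = 0 := by
  let _ := CStarAlgebra.spectralOrder (D.K hd)
  have _ := CStarAlgebra.spectralOrderedRing (D.K hd)
  by_contra hne
  obtain ⟨f, hf, hfa⟩ := exists_positive_functional (star_mul_self_nonneg a)
    ((CStarRing.star_mul_self_ne_zero_iff a).2 hne)
  have h := f.intervalIntegral_comp_comm
    ((D.continuous_gauge_exp hd (star a * a)).intervalIntegrable
      (μ := MeasureTheory.volume) 0 (2 * Real.pi))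
  change _ = f (D.average hd (star a * a)) at h
  rw [ha, map_zero] at h
  -- The functions `θ ↦ f(γ_θ(a* a))`, with `γ_θ` the gauge automorphism at `exp(iθ)`, are
  -- continuous and nonnegative. At `θ = 0` the value is `f(a* a) > 0`, so the integral cannot be
  -- zero.
  refine (intervalIntegral.integral_pos Real.two_pi_pos
    (f.continuous.comp (D.continuous_gauge_exp hd (star a * a))).continuousOn (fun θ _ => ?_)
    ⟨0, ⟨le_rfl, Real.two_pi_pos.le⟩, ?_⟩).ne' h
  · change 0 ≤ f (D.gauge hd (Circle.exp θ) (star a * a))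
    rw [map_mul, map_star]
    exact hf _ (star_mul_self_nonneg _)
  · change 0 < f (D.gauge hd (Circle.exp 0) (star a * a))
    have h1 : D.gauge hd 1 = StarAlgHom.id ℂ _ := Crossed.hom_ext (fun c => by
        have h2 : (D.gauge hd 1).comp (Crossed.incl _) = Crossed.incl _ := Ao.hom_ext fun i j => by
          have := D.gauge_xK hd 1 i j
          rw [one_zpow, Circle.coe_one, one_smul] at this
          exact this
        exact DFunLike.congr_fun h2 c) (by
      have := D.gauge_zK_zpow hd 1 1
      rw [one_zpow, Circle.coe_one, one_smul, zpow_one] at this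
      exact this)
    rw [Circle.exp_zero, h1]
    exact hfa

end BraidedData

/-! ### Bijectivity of `Φ` and injectivity of `φ` -/

namespace EquivariantRep

variable {ζ : Circle} {D : BraidedData ζ} (R : EquivariantRep D) (hd : D.d = 0)

theorem z_zpow_apply (m : ℤ) (f : Seq R.L) (k : ℤ) :
    (((R.z ^ m : unitary R.C) : R.C) : Seq R.L →L[ℂ] Seq R.L) f k = f (k - m) := by
  induction m using Int.induction_on generalizing f k with
  | zero => simp
  | succ m ih =>
    rw [zpow_add_one]
    change (((R.z ^ (m : ℤ) : unitary R.C) : R.C) : Seq R.L →L[ℂ] Seq R.L)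
      ((shiftUnitary R.L : Seq R.L →L[ℂ] Seq R.L) f) k = _
    rw [ih, shiftUnitary_apply]
    exact congrArg f (by ring)
  | pred m ih =>
    rw [zpow_sub_one]
    change (((R.z ^ (-m : ℤ) : unitary R.C) : R.C) : Seq R.L →L[ℂ] Seq R.L)
      (star (shiftUnitary R.L : Seq R.L →L[ℂ] Seq R.L) f) k = _
    rw [ih, star_shiftUnitary_apply]
    exact congrArg f (by ring)

/-- On the span of the elements `z ^ m ψ(b)`, the conditional expectation corresponds to the
diagonal coefficient of operators on `ℓ²(ℤ, L)`. -/
theorem exists_average_eq {a : D.K hd} (ha : a ∈ D.polySpan hd) :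
    ∃ b : BraidedAo D, D.average hd a = (2 * Real.pi : ℂ) • D.psi hd b ∧
      ∀ v : R.L, (R.Phi hd a : Seq R.L →L[ℂ] Seq R.L) (lp.single 2 0 v) 0 = R.hom b v := by
  induction ha using Submodule.span_induction with
  | mem x hx =>
    obtain ⟨⟨m, b⟩, rfl⟩ := hx
    -- The witness is the coefficient of `z^0`.
    refine ⟨if m = 0 then b else 0, ?_, fun v => ?_⟩
    · change D.average hd (_ * _) = _
      rw [D.average_zpow_mul_psi]
      split_ifs
      · rfl
      · rw [map_zero, smul_zero]
    · change (R.Phi hd (_ * _) : Seq R.L →L[ℂ] Seq R.L) (lp.single 2 0 v) 0 = _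
      rw [map_mul, map_coe_zpow (R.Phi hd) (R.Phi_zK hd), Phi_psi]
      change (((R.z ^ m : unitary R.C) : R.C) : Seq R.L →L[ℂ] Seq R.L)
        (R.j₂Hom b (lp.single 2 0 v)) 0 = _
      -- The vector `z^m j₂(b) (1 ⊗ v)` lives in degree `m`, so its component in degree `0` vanishes
      -- for `m ≠ 0`. For `m = 0` the action in degree `0` is `β_1 = id`.
      rw [z_zpow_apply, j₂Hom_apply]
      split_ifs with hm
      · subst hm
        rw [sub_zero, lp.single_apply_self, zpow_zero, action_one]; rfl
      · rw [lp.single_apply_ne _ _ _ (by lia), map_zero, map_zero]; rfl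
  | zero =>
    refine ⟨0, ?_, fun v => ?_⟩
    · have := D.average_smul hd 0 0
      rw [zero_smul, zero_smul] at this
      rw [this, map_zero, smul_zero]
    · rw [map_zero, map_zero]; rfl
  | add x y _ _ hx hy =>
    obtain ⟨b, hb, hb'⟩ := hx
    obtain ⟨c, hc, hc'⟩ := hy
    refine ⟨b + c, ?_, fun v => ?_⟩
    · rw [D.average_add, hb, hc, map_add, smul_add]
    · rw [map_add, map_add, add_apply, ← hb', ← hc']; rfl
  | smul c x _ hx =>
    obtain ⟨b, hb, hb'⟩ := hx
    refine ⟨c • b, ?_, fun v => ?_⟩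
    · rw [D.average_smul, hb, map_smul, smul_comm]
    · rw [map_smul, map_smul]
      change _ = c • R.hom b v
      rw [← hb']; rfl

/-- By density and continuity it suffices to take `a` in the span. There the average is `2π ψ(b)`,
where `R.hom b` is a coefficient of the operator `Φ(a)`, so that `‖ψ(b)‖ ≤ ‖b‖ = ‖R.hom b‖ ≤
‖Φ(a)‖`. -/
theorem norm_average_le_norm_Phi (a : D.K hd) :
    ‖D.average hd a‖ ≤ 2 * Real.pi * ‖R.Phi hd a‖ := by
  have hcl : IsClosed {a : D.K hd | ‖D.average hd a‖ ≤ 2 * Real.pi * ‖R.Phi hd a‖} :=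
    isClosed_le (D.continuous_average hd).norm
      (continuous_const.mul (continuous_starAlgHom (R.Phi hd)).norm)
  refine closure_minimal (fun a ha => ?_) hcl (D.dense_polySpan hd a)
  obtain ⟨b, hb, hb'⟩ := R.exists_average_eq hd ha
  change ‖D.average hd a‖ ≤ 2 * Real.pi * ‖R.Phi hd a‖
  have h1 : ‖(2 * Real.pi : ℂ)‖ = 2 * Real.pi := by
    rw [← Complex.ofReal_ofNat, ← Complex.ofReal_mul, Complex.norm_real,
      Real.norm_of_nonneg Real.two_pi_pos.le]
  rw [hb, norm_smul, h1]
  refine mul_le_mul_of_nonneg_left ?_ Real.two_pi_pos.le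
  refine (NonUnitalStarAlgHom.norm_apply_le (D.psi hd) b).trans ?_
  -- Faithfulness of the representation on `L` enters here: an injective `*`-homomorphism is
  -- isometric.
  rw [← NonUnitalStarAlgHom.norm_map R.hom R.injective b]
  refine ContinuousLinearMap.opNorm_le_bound _ (norm_nonneg _) fun v => ?_
  rw [← hb']
  refine (lp.norm_apply_le_norm two_ne_zero _ 0).trans ?_
  refine (ContinuousLinearMap.le_opNorm _ _).trans ?_
  rw [lp.norm_single (by norm_num)]
  rfl

/-- The norm estimate applied to `a* a` shows that its average vanishes when `Φ(a) = 0`, and the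
average is faithful. -/
theorem Phi_injective : Function.Injective (R.Phi hd) := by
  rw [injective_iff_map_eq_zero]
  intro a ha
  refine D.eq_zero_of_average_eq_zero hd (norm_le_zero_iff.1 ?_)
  have := R.norm_average_le_norm_Phi hd (star a * a)
  rwa [map_mul, ha, mul_zero, norm_zero, mul_zero] at this

/-- Being injective, `Φ` is isometric and has closed range; the range contains the generators `z`
and `j₂(b)` of `C`. -/
theorem Phi_surjective : Function.Surjective (R.Phi hd) := by
  have hcl : IsClosed ((R.Phi hd).range : Set R.C) :=
    (NonUnitalStarAlgHom.isometry (R.Phi hd) (R.Phi_injective hd)).isClosedEmbedding.isClosed_range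
  have hle : R.bosonisation ≤ (R.Phi hd).range.map R.bosonisation.subtype := by
    refine StarSubalgebra.topologicalClosure_minimal (StarAlgebra.adjoin_le ?_) ?_
    · rintro T (rfl | ⟨b, rfl⟩)
      · exact ⟨R.z, ⟨_, R.Phi_zK hd⟩, rfl⟩
      · exact ⟨R.j₂C b, ⟨_, R.Phi_psi hd b⟩, R.j₂Hom_eq b⟩
    · exact (StarSubalgebra.isClosed_topologicalClosure _).isClosedEmbedding_subtypeVal.isClosedMap
        _ hcl
  intro c
  obtain ⟨c', ⟨a, ha⟩, hc⟩ := hle c.2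
  exact ⟨a, ha.trans (Subtype.ext hc)⟩

/-- The isomorphism from the crossed product onto the bosonisation. -/
def PhiEquiv : D.K hd ≃⋆ₐ[ℂ] R.C :=
  StarAlgEquiv.ofBijective (R.Phi hd) ⟨R.Phi_injective hd, R.Phi_surjective hd⟩

theorem phi_injective : Function.Injective (R.phi hd) := by
  have h : R.phi hd = (R.Phi hd).comp (Crossed.incl _) :=
    StarAlgHom.ext fun a => (R.Phi_incl hd a).symm
  rw [h]
  exact (R.Phi_injective hd).comp (Crossed.incl_injective _)

/-- A `*`-homomorphism on the bosonisation is determined by its values at `z` and `u i j`. -/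
theorem hom_ext {B : Type*} [CStarAlgebra B] (hd : D.d = 0) {f g : R.C →⋆ₐ[ℂ] B}
    (hz : f (R.z : R.C) = g (R.z : R.C)) (hu : ∀ i j, f (R.u i j) = g (R.u i j)) : f = g := by
  have ht : ∀ i j, f (R.t i j) = g (R.t i j) := fun i j => by
    -- Both `f` and `g` map `z` to the same unitary, so they agree on all its integer powers, hence
    -- on `t i j`.
    have h1 := map_coe_zpow f (v := R.z) (w := ⟨g (R.z : R.C), Unitary.map_mem g R.z.2⟩)
      hz (D.deg i)
    have h2 := map_coe_zpow g (v := R.z) (w := ⟨g (R.z : R.C), Unitary.map_mem g R.z.2⟩)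
      rfl (D.deg i)
    rw [t, map_mul, map_mul, h1, h2, hu]
  have h : f.comp (R.Phi hd) = g.comp (R.Phi hd) := Crossed.hom_ext (fun a => by
      have h2 : f.comp (R.phi hd) = g.comp (R.phi hd) := Ao.hom_ext fun i j => by
        rw [StarAlgHom.comp_apply, StarAlgHom.comp_apply, phi_x, ht]
      rw [StarAlgHom.comp_apply, StarAlgHom.comp_apply, Phi_incl]
      exact DFunLike.congr_fun h2 a) (by
    rw [StarAlgHom.comp_apply, StarAlgHom.comp_apply, Phi_z, hz])
  refine StarAlgHom.ext fun c => ?_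
  obtain ⟨a, rfl⟩ := R.Phi_surjective hd c
  exact DFunLike.congr_fun h a

/-! ### The comultiplication of the bosonisation -/

/-- The tensor product of two unitaries. -/
def tmulUnitary {A B : Type} [CStarAlgebra A] [CStarAlgebra B] (v : unitary A) (w : unitary B) :
    unitary (MinTensor A B) :=
  ⟨MinTensor.tmul (v : A) (w : B), by
    rw [Unitary.mem_iff, MinTensor.star_tmul, MinTensor.tmul_mul, MinTensor.tmul_mul,
      Unitary.star_mul_self_of_mem v.2, Unitary.star_mul_self_of_mem w.2,
      Unitary.mul_star_self_of_mem v.2, Unitary.mul_star_self_of_mem w.2, ← MinTensor.one_def]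
    exact ⟨rfl, rfl⟩⟩

theorem coe_tmulUnitary {A B : Type} [CStarAlgebra A] [CStarAlgebra B] (v : unitary A)
    (w : unitary B) : (tmulUnitary v w : MinTensor A B) = MinTensor.tmul (v : A) (w : B) := rfl

theorem coe_tmulUnitary_zpow {A B : Type} [CStarAlgebra A] [CStarAlgebra B] (v : unitary A)
    (w : unitary B) (m : ℤ) : ((tmulUnitary v w ^ m : unitary (MinTensor A B)) : MinTensor A B) =
      MinTensor.tmul ((v ^ m : unitary A) : A) ((w ^ m : unitary B) : B) := by
  let f : unitary A × unitary B →* unitary (MinTensor A B) :=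
    { toFun := fun p => tmulUnitary p.1 p.2
      map_one' := Subtype.ext MinTensor.one_def.symm
      map_mul' := fun p q => Subtype.ext (MinTensor.tmul_mul _ _ _ _).symm }
  exact congrArg Subtype.val (map_zpow f (v, w) m).symm

theorem map_comul_x (i j : Fin D.n) :
    MinTensor.map (R.phi hd) (R.phi hd) (Ao.comul D.Ω.transpose (Ao.x D.Ω.transpose i j)) =
      ∑ l, MinTensor.tmul (R.t i l) (R.t l j) := by
  rw [Ao.comul_x, map_sum]
  exact Finset.sum_congr rfl fun l _ => by rw [MinTensor.map_tmul, phi_x, phi_x]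

/-- The comultiplication of the bosonisation, as a `*`-homomorphism on the crossed product. -/
def comulK : D.K hd →⋆ₐ[ℂ] MinTensor R.C R.C :=
  Crossed.lift ((MinTensor.map (R.phi hd) (R.phi hd)).comp (Ao.comul D.Ω.transpose))
    (tmulUnitary R.z R.z) (Ao.covariance_of_x _ _ fun i j => by
      rw [StarAlgHom.comp_apply, map_comul_x, Finset.mul_sum, Finset.sum_mul, Finset.smul_sum]
      refine Finset.sum_congr rfl fun l _ => ?_
      -- The two legs contribute `ζ^(deg i - deg l)` and `ζ^(deg l - deg j)`; their product does not
      -- depend on `l` and is the scalar of `α`.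
      rw [coe_tmulUnitary, MinTensor.tmul_mul, MinTensor.tmul_mul, z_mul_t, z_mul_t,
        MinTensor.smul_tmul, MinTensor.tmul_smul, smul_smul, ← Circle.coe_mul, ← zpow_add,
        sub_add_sub_cancel])

/-- The comultiplication of the bosonisation. -/
def comulC : R.C →⋆ₐ[ℂ] MinTensor R.C R.C :=
  (R.comulK hd).comp ((R.PhiEquiv hd).symm : R.C →⋆ₐ[ℂ] D.K hd)

theorem comulC_Phi (a : D.K hd) : R.comulC hd (R.Phi hd a) = R.comulK hd a :=
  congrArg (R.comulK hd) ((R.PhiEquiv hd).symm_apply_apply a)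

theorem comulC_phi (a : Ao D.Ω.transpose) : R.comulC hd (R.phi hd a) =
    MinTensor.map (R.phi hd) (R.phi hd) (Ao.comul D.Ω.transpose a) := by
  rw [← Phi_incl, comulC_Phi]
  exact Crossed.lift_incl _ _ _ _

theorem comulC_z : R.comulC hd (R.z : R.C) = (tmulUnitary R.z R.z : MinTensor R.C R.C) := by
  rw [← Phi_z R hd, comulC_Phi]
  exact Crossed.lift_z _ _ _

theorem u_eq (i j : Fin D.n) :
    R.u i j = ((R.z ^ (-D.deg i) : unitary R.C) : R.C) * R.t i j := by
  rw [t, ← mul_assoc, coe_zpow_mul_coe_zpow, neg_add_cancel, zpow_zero, Submonoid.coe_one, one_mul]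

/-- Since `u i k = z^(-deg i) t i k`, its image is the sum over `l` of `z^(-deg i) t i l ⊗ z^(-deg
i) t l k`. The first leg is `u i l`; in the second, `t l k = z^(deg l) u l k` leaves the power
`z^(deg l - deg i)`. -/
theorem isComul_comulC : R.IsComul (R.comulC hd) := by
  refine ⟨R.comulC_z hd, fun i k => ?_⟩
  rw [u_eq, map_mul, map_coe_zpow _ (R.comulC_z hd), ← phi_x R hd, comulC_phi, map_comul_x,
    coe_tmulUnitary_zpow, Finset.mul_sum]
  refine Finset.sum_congr rfl fun l _ => ?_
  rw [MinTensor.tmul_mul, ← u_eq, t, ← mul_assoc, coe_zpow_mul_coe_zpow, neg_add_eq_sub]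

end EquivariantRep

end BraidedOrth

end

/-! ### The main theorem -/

theorem mainTheorem6 {ζ : Circle} (D : BraidedOrth.BraidedData ζ) (hd : D.d = 0)
    (R : BraidedOrth.EquivariantRep D) :
    ∃ Δ : R.C →⋆ₐ[ℂ] BraidedOrth.MinTensor R.C R.C,
      R.IsComul Δ ∧ (∀ Δ₁ : R.C →⋆ₐ[ℂ] BraidedOrth.MinTensor R.C R.C, R.IsComul Δ₁ → Δ₁ = Δ) ∧
      ∃ φ : BraidedOrth.Ao D.Ω.transpose →⋆ₐ[ℂ] R.C,
        (∀ i j, φ (BraidedOrth.Ao.x D.Ω.transpose i j) = R.t i j) ∧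
        (∀ φ₁ : BraidedOrth.Ao D.Ω.transpose →⋆ₐ[ℂ] R.C,
          (∀ i j, φ₁ (BraidedOrth.Ao.x D.Ω.transpose i j) = R.t i j) → φ₁ = φ) ∧
        (∀ a, BraidedOrth.MinTensor.map φ φ (BraidedOrth.Ao.comul D.Ω.transpose a) = Δ (φ a)) ∧
        (∃ Φ : BraidedOrth.Crossed
            (BraidedOrth.Ao.twist ζ D.deg (D.transpose_homogeneous hd)) ≃⋆ₐ[ℂ] R.C,
          (∀ a, Φ (BraidedOrth.Crossed.incl _ a) = φ a) ∧
          Φ (BraidedOrth.Crossed.z _) = (R.z : R.C)) ∧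
        Function.Injective φ :=
  ⟨R.comulC hd, R.isComul_comulC hd,
    fun Δ₁ h => R.hom_ext hd (h.1.trans (R.isComul_comulC hd).1.symm) fun i j =>
      (h.2 i j).trans ((R.isComul_comulC hd).2 i j).symm,
    R.phi hd, R.phi_x hd,
    fun φ₁ h => BraidedOrth.Ao.hom_ext fun i j => (h i j).trans (R.phi_x hd i j).symm,
    fun a => (R.comulC_phi hd a).symm,
    ⟨R.PhiEquiv hd, R.Phi_incl hd, R.Phi_z hd⟩, R.phi_injective hd⟩
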